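/- Let $G=(V,E)$ be a finite connected graph without loops (parallel edges are allowed), let $\mathbb E$ be the set of its oriented edges, write $e=uv$ if $e\in\mathbb E$ points from $u$ to $v$, and let $\bar e$ be $e$ with the reverse orientation. For $A=\mathbb Z,\mathbb R$ let $C^0(G,A)$ be the module of functions $V\to A$ and $C^1(G,A)$ the module of functions $\alpha:\mathbb E\to A$ with $\alpha(\bar e)=-\alpha(e)$. Let $d:C^0(G,A)\to C^1(G,A)$, $d(f)(uv)=f(v)-f(u)$, let $d^*:C^1(G,A)\to C^0(G,A)$, $d^*(\alpha)(v)=\sum_{e\text{ with head }v}\alpha(e)$, be its adjoint, $\Delta=d^*d$, and $H_{0,\mathbb R}=\{f\in C^0(G,\mathbb R): \sum_{v} f(v)=0\}$. For a connected spanning subgraph $G'$ of $G$ with Laplacian $\Delta'$, let $q'$ be the quadratic form on $H_{0,\mathbb R}$ given by $q'(h)=\sum_v f(v)h(v)$ for any $f$ with $\Delta' f=h$; the cut Voronoi polytope of $G'$ is $$\mathrm{Vor}_{G'}(O)=\{x\in H_{0,\mathbb R} : q'(x)\le q'(x-y)\text{ for all } y\in \Delta'(C^0(G,\mathbb Z))\}.$$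 Let $\ell:E\to\mathbb Z_{>0}$ be a function (the edge lengths) and $\mathfrak m\in C^1(G,\mathbb Z)$ (the twisting). For $f\in C^0(G,\mathbb Z)$ and $e=uv\in\mathbb E$ put $$\delta^{\mathfrak m}_e(f)=\Big\lfloor \tfrac{f(v)-f(u)+\mathfrak m_e}{\ell_e}\Big\rfloor,\qquad \mathfrak d^{\mathfrak m}_f(e)=\tfrac12\big(\delta^{\mathfrak m}_e(f)-\delta^{\mathfrak m}_{\bar e}(f)\big),$$ so that $\mathfrak d^{\mathfrak m}_f\in C^1(G,\mathbb R)$; let $G^{\mathfrak m}_f$ be the spanning subgraph of $G$ whose edges are those $e=uv$ with $\ell_e\mid f(v)-f(u)+\mathfrak m_e$; let $\square^{\mathfrak m}_f$ be the set of all $\mathfrak d^{\mathfrak m}_f+\epsilon$ with $\epsilon\in C^1(G,\mathbb R)$, $|\epsilon(e)|\le\frac12$ for all $e$, and $\epsilon(e)=0$ for $e$ not in $G^{\mathfrak m}_f$; and let $\mathrm{Vor}^{\mathfrak m}_H(f)=d^*(\square^{\mathfrak m}_f)$. Let $\mathcal F$ be the family of all nonempty faces (including the polytopes themselves) of the sets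 $\mathrm{Vor}^{\mathfrak m}_H(f)$, over all $f\in C^0(G,\mathbb Z)$ with $G^{\mathfrak m}_f$ connected. Then: 1. $\mathcal F$ is a tiling of $H_{0,\mathbb R}$ by polytopes: its members are convex polytopes whose union is $H_{0,\mathbb R}$, each nonempty face of a member of $\mathcal F$ belongs to $\mathcal F$, and the intersection of two members of $\mathcal F$ is either empty or a common face of both. 2. The members of $\mathcal F$ of top dimension $|V|-1$ are exactly the $\mathrm{Vor}^{\mathfrak m}_H(f)$ with $f\in C^0(G,\mathbb Z)$ and $G^{\mathfrak m}_f$ connected. 3. For each $f\in C^0(G,\mathbb Z)$ with $G^{\mathfrak m}_f$ connected, $\mathrm{Vor}^{\mathfrak m}_H(f)=d^*(\mathfrak d^{\mathfrak m}_f)+\mathrm{Vor}_{G^{\mathfrak m}_f}(O)$. Thus each top-dimensional cell of the tiling is a translate of, hence congruent to, the cut Voronoi polytope of a connected spanning subgraph of $G$. -/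

import Mathlib

open scoped Graph Pointwise

namespace GraphTiling

variable {α β : Type*}

/-- An oriented edge of a multigraph: an edge together with a choice of one of its two
orientations, pointing from `tail` to `head`. (In a loopless graph every edge carries exactly two
arrows, even if it is one of several parallel edges.) -/
structure Arrow (G : Graph α β) where
  /-- the underlying edge -/
  edge : E(G)
  /-- the vertex that the arrow leaves -/
  tail : V(G)
  /-- the vertex that the arrow enters -/
  head : V(G)
  /-- the two vertices are the ends of the edge -/
  isLink : G.IsLink edge.1 tail.1 head.1

/-- The same edge with the opposite orientation. -/
def Arrow.rev {G : Graph α β} (e : Arrow G) : Arrow G where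
  edge := e.edge
  tail := e.head
  head := e.tail
  isLink := e.isLink.symm

theorem Arrow.rev_rev {G : Graph α β} (e : Arrow G) : e.rev.rev = e := rfl

/-- `G` is connected (in particular it has a vertex). -/
def IsConnected (G : Graph α β) : Prop := G.toSimpleGraph.Connected

/-- The `0`-cochains `C⁰(G, A)`: functions on the vertices. -/
abbrev C0 (G : Graph α β) (A : Type*) : Type _ := V(G) → A

/-- The `1`-cochains `C¹(G, A)`: functions on the oriented edges that change sign under
reversal of the orientation. -/
def C1 (G : Graph α β) (A : Type*) [CommRing A] : Submodule A (Arrow G → A) where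
  carrier := {a | ∀ e, a e.rev = -a e}
  add_mem' {a b} ha hb e := by
    simp only [Set.mem_ofPred_eq] at ha hb
    simp only [Pi.add_apply, ha e, hb e]
    ring
  zero_mem' e := by simp
  smul_mem' c a ha e := by
    simp only [Set.mem_ofPred_eq] at ha
    simp [ha e]

/-- The coboundary `d : C⁰(G, A) → C¹(G, A)`, `d f (uv) = f v - f u`. -/
def d {G : Graph α β} {A : Type*} [CommRing A] (f : C0 G A) : C1 G A :=
  ⟨fun e => f e.head - f e.tail, fun e => by simp [Arrow.rev]⟩

/-- The adjoint `d* : C¹(G, A) → C⁰(G, A)`: the value at `v` is the sum over all oriented edges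
with head `v` (a finite sum when `G` is finite). -/
noncomputable def dStar {G : Graph α β} {A : Type*} [CommRing A] (a : C1 G A) : C0 G A :=
  fun v => ∑ᶠ (e : Arrow G) (_ : e.head = v), a.1 e

/-- The Laplacian `Δ = d* d` of `G`. -/
noncomputable def laplacian {G : Graph α β} {A : Type*} [CommRing A] (f : C0 G A) : C0 G A :=
  dStar (d f)

/-- The standard scalar product on `C⁰(G, A)`. -/
noncomputable def pairing {G : Graph α β} {A : Type*} [CommRing A] (f g : C0 G A) : A :=
  ∑ᶠ v, f v * g v

/-- The space `H_{0,ℝ}` of real functions on the vertices with sum zero. -/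
def H0 (G : Graph α β) : Set (C0 G ℝ) := {f | ∑ᶠ v, f v = 0}

/-- The Laplacian lattice `Λ_ℤ = d*(d(C⁰(G, ℤ)))`, inside `C⁰(G, ℝ)`. -/
def laplacianLattice (G : Graph α β) : Set (C0 G ℝ) :=
  {x | ∃ n : C0 G ℤ, x = fun v => ((laplacian n v : ℤ) : ℝ)}

open Classical in
/-- The quadratic form `q(h) = ⟨f, Δ f⟩`, where `f` is any function with `Δ f = h`. For connected
`G` such `f` exist for all `h` in `H_{0,ℝ}`; the value does not depend on the choice of `f`, see
`laplacianForm_eq`. -/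
noncomputable def laplacianForm {G : Graph α β} (h : C0 G ℝ) : ℝ :=
  if hh : ∃ f : C0 G ℝ, laplacian f = h then pairing hh.choose (laplacian hh.choose) else 0

/-- The cut Voronoi polytope `Vor_G(O)` of `G`: the Voronoi cell of the origin in `H_{0,ℝ}`, with
respect to the Laplacian lattice and the quadratic form `q`. -/
def cutVoronoi (G : Graph α β) : Set (C0 G ℝ) :=
  {x | x ∈ H0 G ∧ ∀ y ∈ laplacianLattice G, laplacianForm x ≤ laplacianForm (x - y)}

section Twisted

variable {G : Graph α β} (l : E(G) → ℕ) (m : C1 G ℤ) (f : C0 G ℤ)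

/-- `δ_e = ⌊(f(v) - f(u) + m_e) / ℓ_e⌋` for an oriented edge `e = uv`. -/
noncomputable def delta (e : Arrow G) : ℤ :=
  ⌊((f e.head - f e.tail + m.1 e : ℤ) : ℝ) / (l e.edge : ℝ)⌋

/-- The point `𝔡` of `C¹(G, ½ℤ)`, viewed in `C¹(G, ℝ)`, with value
`(δ_e - δ_{e reversed}) / 2` at `e`. -/
noncomputable def dPoint : C1 G ℝ :=
  ⟨fun e => ((delta l m f e : ℝ) - (delta l m f e.rev : ℝ)) / 2, fun e => by
    simp only [Arrow.rev_rev]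
    ring⟩

/-- The edges `e = uv` for which `ℓ_e` divides `f(v) - f(u) + m_e` (this does not depend on the
orientation of `e`). -/
def integralEdges : Set β :=
  {b | ∃ e : Arrow G, e.edge.1 = b ∧ (l e.edge : ℤ) ∣ f e.head - f e.tail + m.1 e}

/-- The spanning subgraph `G_f^m` of `G`. -/
def subgraph : Graph α β := G.restrict (integralEdges l m f)

/-- The cut Voronoi polytope of `G_f^m`. As `G_f^m` has by definition the same vertices as `G`,
it is a subset of `C⁰(G, ℝ)`. -/
def subgraphVoronoi : Set (C0 G ℝ) := cutVoronoi (subgraph l m f)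

/-- The cube `□_f^m` centered at `𝔡`, in the directions of the edges of `G_f^m`. -/
def cube : Set (C1 G ℝ) :=
  {a | ∃ ε : C1 G ℝ, (∀ e, |ε.1 e| ≤ 1 / 2) ∧
    (∀ e : Arrow G, e.edge.1 ∉ E(subgraph l m f) → ε.1 e = 0) ∧ a = dPoint l m f + ε}

/-- The polytope `Vor_H^m(f) = d*(□_f^m)`. -/
def tile : Set (C0 G ℝ) := dStar '' cube l m f

end Twisted

section Tilings

variable {W : Type*} [AddCommGroup W] [Module ℝ W]

/-- A (nonempty) convex polytope. -/
def IsPolytope (P : Set W) : Prop :=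
  ∃ s : Set W, s.Finite ∧ s.Nonempty ∧ P = convexHull ℝ s

/-- `Q` is a nonempty face of `P`; `P` is a face of itself. -/
def IsFace [TopologicalSpace W] (P Q : Set W) : Prop :=
  Q.Nonempty ∧ IsExposed ℝ P Q

/-- The dimension of (the affine hull of) a subset of a vector space. -/
noncomputable def dim (P : Set W) : ℕ := Module.finrank ℝ (vectorSpan ℝ P)

/-- The family `F` of polytopes is a (face-to-face) tiling of `H`: the polytopes lie in `H` and
cover it, each face of a polytope in `F` belongs to `F`, and two polytopes in `F` are disjoint or
meet in a common face. -/
structure IsTiling [TopologicalSpace W] (H : Set W) (F : Set (Set W)) : Prop where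
  polytope : ∀ P ∈ F, IsPolytope P
  sUnion_eq : ⋃₀ F = H
  face_mem : ∀ P ∈ F, ∀ Q, IsFace P Q → Q ∈ F
  inter : ∀ P ∈ F, ∀ Q ∈ F, (P ∩ Q).Nonempty → IsFace P (P ∩ Q) ∧ IsFace Q (P ∩ Q)

end Tilings

/-- The family of all polytopes `Vor_H^m(f)` with `G_f^m` connected, and all their faces. -/
def cells {G : Graph α β} (l : E(G) → ℕ) (m : C1 G ℤ) : Set (Set (C0 G ℝ)) :=
  {Q | ∃ f : C0 G ℤ, IsConnected (subgraph l m f) ∧ IsFace (tile l m f) Q}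

/-! Independence of `laplacianForm` of the choice that it makes. -/

theorem finite_arrow (G : Graph α β) [Finite V(G)] [Finite E(G)] : Finite (Arrow G) := by
  refine Finite.of_injective
    (fun e : Arrow G => (e.edge, e.tail, e.head)) ?_
  rintro ⟨a, b, c, h⟩ ⟨a', b', c', h'⟩ hh
  simp only [Prod.mk.injEq] at hh
  obtain ⟨rfl, rfl, rfl⟩ := hh
  rfl

/-- `d*` is adjoint to `d`. The scalar product of `C¹` is a sum over unoriented edges, that is,
half of the sum over all oriented edges. -/
theorem pairing_dStar {G : Graph α β} [Finite V(G)] [Finite E(G)] (f : C0 G ℝ) (a : C1 G ℝ) :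
    pairing f (dStar a) = (∑ᶠ e, (d f).1 e * a.1 e) / 2 := by
  classical
  have := finite_arrow G
  let _ := Fintype.ofFinite V(G)
  let _ := Fintype.ofFinite (Arrow G)
  have h1 : pairing f (dStar a) = ∑ e : Arrow G, f e.head * a.1 e := by
    simp only [pairing, dStar, finsum_eq_sum_of_fintype, finsum_eq_if, Finset.mul_sum]
    rw [Finset.sum_comm]
    refine Finset.sum_congr rfl fun e _ => ?_
    simp
  have h2 : ∑ e : Arrow G, f e.tail * a.1 e = -∑ e : Arrow G, f e.head * a.1 e := by
    rw [← Finset.sum_neg_distrib]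
    refine Finset.sum_nbij' Arrow.rev Arrow.rev (by simp) (by simp)
      (fun e _ => Arrow.rev_rev e) (fun e _ => Arrow.rev_rev e) fun e _ => ?_
    rw [a.2 e]
    simp [Arrow.rev]
  rw [finsum_eq_sum_of_fintype, h1]
  simp only [d, sub_mul, Finset.sum_sub_distrib]
  rw [h2]
  ring

theorem laplacianForm_eq {G : Graph α β} [Finite V(G)] [Finite E(G)] (f : C0 G ℝ) :
    laplacianForm (laplacian f) = pairing f (laplacian f) := by
  have symm : ∀ g h : C0 G ℝ, pairing g (laplacian h) = pairing h (laplacian g) := by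
    intro g h
    simp only [laplacian, pairing_dStar]
    congr 2
    ext e
    ring
  have hh : ∃ g : C0 G ℝ, laplacian g = laplacian f := ⟨f, rfl⟩
  rw [laplacianForm, dif_pos hh, hh.choose_spec, symm, hh.choose_spec]

end GraphTiling

/-! The tiling is the family of subdifferentials of a convex energy on integral functions. Let φ_l
be the convex piecewise linear function on ℤ that agrees with t²/(2l) at multiples of l, and let
E(f) be half the sum over all arrows e = uv of φ at f(v) - f(u) + m_e. The subgradients of φ_l at t
form a point or, if l ∣ t, an interval of length one. So the cube of f consists of the cochains that
pick a subgradient on every arrow (`mem_cube_iff`), and its image under d* is the set of x in H₀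
with E(f) + ⟨g - f, x⟩ ≤ E(g) for all integral g (`mem_tile_iff`). One inclusion is a sum over
arrows. For the other, the inequalities for g = f + 1_S are cut conditions on x; a layer-cake
decomposition (`sum_mul_le_of_cuts`) extends them to all real potentials, and separation of convex
sets finishes.

Two tiles meet where the inequality between them is sharp, which is an exposed face of both
(`isFace_tile_inter`). Each x in H₀ lies in the tile of a minimiser of E - ⟨·, x⟩, which exists by
coercivity. If the graph of f is disconnected, raising f on one side of an empty cut until a
crossing edge becomes integral enlarges the cube (`exists_cube_supset`), so a maximal set of
integral edges gives a connected graph.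

For unit lengths and no twisting, E is half the Dirichlet form and the subgradient inequality at 0
is the Voronoi inequality. Hence the cut Voronoi polytope is d* of a centred cube
(`IsConnected.cutVoronoi_eq_tile`), and a tile is its translate by d*(𝔡). A tile with connected
graph contains small translates of its centre along all edges of that graph, hence has full
dimension; a functional exposing a face of full dimension is constant on the tile. -/

namespace GraphTiling

variable {α β : Type*}

/-! ### Exposed faces of polytopes. -/

section Polytopes

variable {W : Type*} [AddCommGroup W] [Module ℝ W] [TopologicalSpace W]

theorem convex_toExposed (l : StrongDual ℝ W) {P : Set W} (hP : Convex ℝ P) :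
    Convex ℝ (l.toExposed P) :=
  (ContinuousLinearMap.toExposed.isExposed (l := l)).convex hP

theorem le_of_mem_convexHull (l : StrongDual ℝ W) {s : Set W} {M : ℝ} (h : ∀ y ∈ s, l y ≤ M)
    {x : W} (hx : x ∈ convexHull ℝ s) : l x ≤ M :=
  convexHull_min (t := {y | l y ≤ M}) h (convex_halfSpace_le l.isLinear M) hx

/-- An exposed face of the convex hull of a finite set is the convex hull of an exposed face of
that set. -/
theorem toExposed_convexHull (l : StrongDual ℝ W) {s : Set W} (hs : s.Finite) :
    l.toExposed (convexHull ℝ s) = convexHull ℝ (l.toExposed s) := by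
  rcases s.eq_empty_or_nonempty with rfl | hne
  · simp [ContinuousLinearMap.toExposed]
  obtain ⟨z, hz, hmax⟩ := Set.exists_max_image s l hs hne
  have hT : l.toExposed s = {x ∈ s | l x = l z} := by
    ext x
    exact ⟨fun h => ⟨h.1, le_antisymm (hmax x h.1) (h.2 z hz)⟩,
      fun h => ⟨h.1, fun y hy => h.2 ▸ hmax y hy⟩⟩
  apply Set.Subset.antisymm
  · rintro x ⟨hx, hxm⟩
    have hxz : l z ≤ l x := hxm z (subset_convexHull ℝ s hz)
    set T := l.toExposed s
    have hTne : T.Nonempty := ⟨z, hz, hmax⟩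
    have hsplit : s = T ∪ (s \ T) := by
      rw [Set.union_sdiff_cancel]
      exact fun y hy => hy.1
    rcases (s \ T).eq_empty_or_nonempty with hU | hU
    · rw [hU, Set.union_empty] at hsplit
      rwa [← hsplit]
    rw [hsplit, convexHull_union hTne hU, mem_convexJoin] at hx
    obtain ⟨a, ha, b, hb, p, q, hp, hq, hpq, rfl⟩ := hx
    have ha' : l a ≤ l z := le_of_mem_convexHull l (fun y hy => hmax y hy.1) ha
    have hb' : l b < l z := by
      refine convexHull_min (t := {y | l y < l z}) (fun y hy => ?_)
        (convex_halfSpace_lt l.isLinear _) hb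
      refine lt_of_le_of_ne (hmax y hy.1) fun h => hy.2 ?_
      rw [hT]
      exact ⟨hy.1, h⟩
    -- Any weight on the non-maximising points would push the value strictly below the maximum.
    have hq0 : q = 0 := by
      by_contra hq0
      have hq1 : 0 < q := lt_of_le_of_ne hq (Ne.symm hq0)
      simp only [map_add, map_smul, smul_eq_mul] at hxz
      have hp' : p = 1 - q := by linarith
      subst hp'
      nlinarith
    subst hq0
    have hp1 : p = 1 := by linarith
    subst hp1
    simpa using ha
  · refine convexHull_min (fun x hx => ⟨subset_convexHull ℝ s hx.1, fun y hy => ?_⟩)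
      (convex_toExposed l (convex_convexHull ℝ s))
    exact le_of_mem_convexHull l hx.2 hy

/-- Maximising lexicographically over a finite set is maximising one functional. -/
theorem exists_toExposed_toExposed [IsTopologicalAddGroup W] [ContinuousSMul ℝ W]
    (l₁ l₂ : StrongDual ℝ W) {s : Set W}
    (hs : s.Finite) : ∃ l : StrongDual ℝ W, l.toExposed s = l₂.toExposed (l₁.toExposed s) := by
  -- The functional will be `l₁ + ε • l₂`: on a finite set, a small ε preserves all strict
  -- inequalities of `l₁`, so `l₂` only breaks ties.
  have key : ∀ᶠ ε : ℝ in nhdsWithin 0 (Set.Ioi 0), ∀ x ∈ s, ∀ y ∈ s, l₁ y < l₁ x →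
      l₁ y + ε * l₂ y < l₁ x + ε * l₂ x := by
    rw [Filter.eventually_all_finite hs]
    intro x _
    rw [Filter.eventually_all_finite hs]
    intro y _
    by_cases h : l₁ y < l₁ x
    · have : ∀ᶠ ε : ℝ in nhds 0, l₁ y + ε * l₂ y < l₁ x + ε * l₂ x := by
        apply ContinuousAt.eventually_lt
        · fun_prop
        · fun_prop
        · simpa using h
      filter_upwards [nhdsWithin_le_nhds this] with ε hε _ using hε
    · exact Filter.Eventually.of_forall fun _ h' => absurd h' h
  obtain ⟨ε, hε, hε0⟩ := (key.and self_mem_nhdsWithin).exists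
  have hε0 : 0 < ε := hε0
  rcases s.eq_empty_or_nonempty with rfl | hne
  · exact ⟨0, by simp [ContinuousLinearMap.toExposed]⟩
  refine ⟨l₁ + ε • l₂, ?_⟩
  ext x
  constructor
  · rintro ⟨hx, hm⟩
    have h1 : ∀ y ∈ s, l₁ y ≤ l₁ x := by
      intro y hy
      by_contra h
      have h2 := hε y hy x hx (not_le.1 h)
      have h3 := hm y hy
      simp at h3
      linarith
    refine ⟨⟨hx, h1⟩, fun y hy => ?_⟩
    have h3 := hm y hy.1
    have h4 := hy.2 x hx
    have h5 := h1 y hy.1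
    simp at h3
    have : ε * l₂ y ≤ ε * l₂ x := by linarith
    exact le_of_mul_le_mul_left this hε0
  · rintro ⟨⟨hx, h1⟩, h2⟩
    refine ⟨hx, fun y hy => ?_⟩
    simp only [add_apply, smul_apply, smul_eq_mul]
    rcases (h1 y hy).lt_or_eq with h | h
    · exact (hε x hx y hy h).le
    · have : l₂ y ≤ l₂ x := h2 y ⟨hy, fun z hz => h ▸ h1 z hz⟩
      have := mul_le_mul_of_nonneg_left this hε0.le
      linarith

theorem IsFace.exists_toExposed {P Q : Set W} (h : IsFace P Q) :
    ∃ l : StrongDual ℝ W, Q = l.toExposed P :=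
  h.2 h.1

theorem IsPolytope.of_isFace {P Q : Set W} (hP : IsPolytope P) (h : IsFace P Q) :
    IsPolytope Q := by
  obtain ⟨s, hs, -, rfl⟩ := hP
  obtain ⟨l, rfl⟩ := h.exists_toExposed
  have hne := h.1
  rw [toExposed_convexHull l hs] at hne ⊢
  exact ⟨_, hs.subset fun x hx => hx.1, convexHull_nonempty_iff.1 hne, rfl⟩

/-- A face of a face of a polytope is a face. -/
theorem IsFace.trans [IsTopologicalAddGroup W] [ContinuousSMul ℝ W] {P Q R : Set W}
    (hP : IsPolytope P) (h : IsFace P Q) (h' : IsFace Q R) : IsFace P R := by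
  refine ⟨h'.1, fun _ => ?_⟩
  obtain ⟨s, hs, -, rfl⟩ := hP
  obtain ⟨l₁, rfl⟩ := h.exists_toExposed
  obtain ⟨l₂, rfl⟩ := h'.exists_toExposed
  -- Exposed faces of general convex sets are not transitive; the finite generating set is what
  -- makes this work.
  obtain ⟨l, hl⟩ := exists_toExposed_toExposed l₁ l₂ hs
  refine ⟨l, ?_⟩
  change _ = l.toExposed _
  rw [toExposed_convexHull l₁ hs, toExposed_convexHull l hs, hl,
    toExposed_convexHull l₂ (hs.subset fun x hx => hx.1)]

theorem IsFace.refl {P : Set W} (h : P.Nonempty) : IsFace P P := ⟨h, IsExposed.refl P⟩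

/-- If a family of polytopes meets pairwise in common faces, then so do their faces. -/
theorem IsFace.inter [IsTopologicalAddGroup W] [ContinuousSMul ℝ W] {P P' Q Q' : Set W}
    (hP : IsPolytope P) (hPP' : (P ∩ P').Nonempty → IsFace P (P ∩ P') ∧ IsFace P' (P ∩ P'))
    (hQ : IsFace P Q) (hQ' : IsFace P' Q') (hne : (Q ∩ Q').Nonempty) :
    IsFace Q (Q ∩ Q') := by
  have hsub := hQ.2.subset
  have hsub' := hQ'.2.subset
  obtain ⟨h1, h2⟩ := hPP' (hne.mono (Set.inter_subset_inter hsub hsub'))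
  have hne' : (P ∩ P' ∩ Q').Nonempty :=
    hne.mono fun x hx => ⟨⟨hsub hx.1, hsub' hx.2⟩, hx.2⟩
  -- `Q'` cuts a face out of `P ∩ P'`, hence by transitivity out of `P`; intersecting with the face
  -- `Q` of `P` then gives the claim.
  have h3 : IsFace (P ∩ P') (P ∩ P' ∩ Q') :=
    ⟨hne', (h2.2.inter hQ'.2).mono Set.inter_subset_right Set.inter_subset_left⟩
  have h4 := (IsFace.trans hP h1 h3).2.inter hQ.2
  have h5 : P ∩ P' ∩ Q' ∩ Q = Q ∩ Q' := by
    ext x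
    exact ⟨fun h => ⟨h.2, h.1.2⟩, fun h => ⟨⟨⟨hsub h.1, hsub' h.2⟩, h.2⟩, h.1⟩⟩
  rw [h5] at h4
  exact ⟨hne, h4.mono hsub Set.inter_subset_left⟩

end Polytopes

/-! ### The one-variable convex function and its subgradients. -/

section Phi

/-- The piecewise linear convex function on `ℤ` that interpolates `t ↦ t² / (2l)` between the
multiples of `l`. -/
noncomputable def phi (l : ℕ) (t : ℤ) : ℝ :=
  (((t / l : ℤ) : ℝ) + 1 / 2) * t - l * ((t / l : ℤ) : ℝ) * (((t / l : ℤ) : ℝ) + 1) / 2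

/-- Neighbouring linear pieces agree at their common breakpoint, so the right end may be included.
This spares later arguments a case distinction on divisibility. -/
theorem phi_eq_of_bounds {l : ℕ} {t k : ℤ} (h1 : k * l ≤ t) (h2 : t ≤ (k + 1) * l)
    (hl : 0 < l) : phi l t = (k + 1 / 2) * t - l * k * (k + 1) / 2 := by
  have hl' : (0 : ℤ) < l := by exact_mod_cast hl
  rcases h2.lt_or_eq with h2 | h2
  · have : t / l = k := by
      rw [Int.ediv_eq_iff_of_pos hl']
      constructor <;> nlinarith
    rw [phi, this]
  · have : t / l = k + 1 := by rw [h2]; exact Int.mul_ediv_cancel _ hl'.ne'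
    rw [phi, this, h2]
    push_cast
    ring

theorem ediv_mul_le_self {l : ℕ} (hl : 0 < l) (t : ℤ) : t / l * l ≤ t :=
  Int.ediv_mul_le t (by exact_mod_cast hl.ne')

theorem le_ediv_add_one_mul {l : ℕ} (hl : 0 < l) (t : ℤ) : t + 1 ≤ (t / l + 1) * l :=
  Int.lt_ediv_add_one_mul_self t (by exact_mod_cast hl)

theorem phi_succ {l : ℕ} (hl : 0 < l) (t : ℤ) :
    phi l (t + 1) = phi l t + (((t / l : ℤ) : ℝ) + 1 / 2) := by
  have h1 := ediv_mul_le_self hl t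
  have h2 := le_ediv_add_one_mul hl t
  rw [phi_eq_of_bounds (k := t / l) (by lia) h2 hl, phi]
  push_cast
  ring

theorem phi_neg {l : ℕ} (hl : 0 < l) (t : ℤ) : phi l (-t) = phi l t := by
  have h1 := ediv_mul_le_self hl t
  have h2 := le_ediv_add_one_mul hl t
  rw [phi_eq_of_bounds (t := -t) (k := -(t / l) - 1) (by linarith) (by linarith) hl, phi]
  push_cast
  ring

/-- Convexity: `phi l` is the maximum of its linear pieces. With k = ⌊t/l⌋ the difference is (k -
j)(t - kl) + l(k - j)(k - j - 1)/2, and the last product is nonnegative because k - j is an integer.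
-/
theorem le_phi {l : ℕ} (hl : 0 < l) (t j : ℤ) :
    (j + 1 / 2 : ℝ) * t - l * j * (j + 1) / 2 ≤ phi l t := by
  have h1 : ((t / l : ℤ) : ℝ) * l ≤ t := by exact_mod_cast ediv_mul_le_self hl t
  have h2 : (t : ℝ) + 1 ≤ (((t / l : ℤ) : ℝ) + 1) * l := by
    exact_mod_cast le_ediv_add_one_mul hl t
  have hl' : (0 : ℝ) < l := by exact_mod_cast hl
  rw [phi]
  generalize t / (l : ℤ) = k at *
  rcases lt_trichotomy j k with h | rfl | h
  · have h : (j : ℝ) + 1 ≤ k := by exact_mod_cast h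
    nlinarith [mul_nonneg (sub_nonneg.2 h1) (by linarith : (0 : ℝ) ≤ k - j),
      mul_nonneg (mul_nonneg hl'.le (by linarith : (0 : ℝ) ≤ k - j))
        (by linarith : (0 : ℝ) ≤ k - j - 1)]
  · exact le_rfl
  · have h : (k : ℝ) + 1 ≤ j := by exact_mod_cast h
    nlinarith [mul_nonneg (sub_nonneg.2 h2) (by linarith : (0 : ℝ) ≤ j - k),
      mul_nonneg (mul_nonneg hl'.le (by linarith : (0 : ℝ) ≤ j - k))
        (by linarith : (0 : ℝ) ≤ j - k - 1)]

theorem phi_add_mul_le_of_le {l : ℕ} (hl : 0 < l) {t t' : ℤ} {s : ℝ}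
    (hs : s ≤ ((t / l : ℤ) : ℝ) + 1 / 2) (h : t ≤ t') :
    phi l t + s * (t' - t) ≤ phi l t' := by
  refine le_trans ?_ (le_phi hl t' (t / l))
  have h : (t : ℝ) ≤ t' := by exact_mod_cast h
  rw [phi]
  nlinarith [mul_le_mul_of_nonneg_right hs (sub_nonneg.2 h)]

/-- The subgradient inequality for `phi`. -/
theorem phi_add_mul_le {l : ℕ} (hl : 0 < l) {t : ℤ} (t' : ℤ) {s : ℝ}
    (hs : s ≤ ((t / l : ℤ) : ℝ) + 1 / 2) (hs' : -s ≤ ((-t / l : ℤ) : ℝ) + 1 / 2) :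
    phi l t + s * (t' - t) ≤ phi l t' := by
  rcases le_total t t' with h | h
  · exact phi_add_mul_le_of_le hl hs h
  · have := phi_add_mul_le_of_le hl hs' (neg_le_neg h)
    rw [phi_neg hl, phi_neg hl] at this
    push_cast at this
    linarith

/-- A subgradient of `phi` at `t` for which the subgradient inequality is sharp at `t'` is bounded
by the slope of `phi` to the right of `t'`. -/
theorem le_of_phi_add_mul_eq {l : ℕ} (hl : 0 < l) {t t' : ℤ} {s : ℝ}
    (hs : s ≤ ((t / l : ℤ) : ℝ) + 1 / 2) (hs' : -s ≤ ((-t / l : ℤ) : ℝ) + 1 / 2)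
    (h : phi l t + s * (t' - t) = phi l t') : s ≤ ((t' / l : ℤ) : ℝ) + 1 / 2 := by
  have := phi_add_mul_le hl (t' + 1) hs hs'
  rw [phi_succ hl] at this
  push_cast at this
  linarith

end Phi

/-! ### Arrows, reversal and the adjoint d*. -/

section Cochains

variable {G : Graph α β}

theorem Arrow.eq_or_eq_rev {e e' : Arrow G} (h : e.edge = e'.edge) : e' = e ∨ e' = e.rev := by
  obtain ⟨b, u, v, h1⟩ := e
  obtain ⟨b', u', v', h2⟩ := e'
  dsimp only at h
  subst h
  rcases h1.eq_and_eq_or_eq_and_eq h2 with h | h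
  · left
    simp only [Arrow.mk.injEq, true_and]
    exact ⟨Subtype.ext h.1.symm, Subtype.ext h.2.symm⟩
  · right
    simp only [Arrow.rev, Arrow.mk.injEq, true_and]
    exact ⟨Subtype.ext h.2.symm, Subtype.ext h.1.symm⟩

@[simp] theorem Arrow.rev_head (e : Arrow G) : e.rev.head = e.tail := rfl
@[simp] theorem Arrow.rev_tail (e : Arrow G) : e.rev.tail = e.head := rfl
@[simp] theorem Arrow.rev_edge (e : Arrow G) : e.rev.edge = e.edge := rfl

/-- Reversal as a permutation of the arrows. -/
def revEquiv (G : Graph α β) : Equiv.Perm (Arrow G) where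
  toFun := Arrow.rev
  invFun := Arrow.rev
  left_inv := Arrow.rev_rev
  right_inv := Arrow.rev_rev

theorem sum_rev [Fintype (Arrow G)] (F : Arrow G → ℝ) : ∑ e, F (Arrow.rev e) = ∑ e, F e :=
  Equiv.sum_comp (revEquiv G) F

theorem C1.map_rev {A : Type*} [CommRing A] (a : C1 G A) (e : Arrow G) :
    a.1 e.rev = -a.1 e := a.2 e

open Classical in
theorem dStar_apply [Fintype (Arrow G)] (a : C1 G ℝ) (v : V(G)) :
    dStar a v = ∑ e, if e.head = v then a.1 e else 0 := by
  simp only [dStar, finsum_eq_sum_of_fintype, finsum_eq_if]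

/-- `d*` as a linear map. -/
noncomputable def dStarLin (G : Graph α β) [Finite V(G)] [Finite E(G)] :
    C1 G ℝ →ₗ[ℝ] C0 G ℝ where
  toFun := dStar
  map_add' a b := by
    classical
    have := finite_arrow G
    let _ := Fintype.ofFinite (Arrow G)
    ext v
    simp only [dStar_apply, Pi.add_apply, ← Finset.sum_add_distrib]
    refine Finset.sum_congr rfl fun e _ => ?_
    split_ifs <;> simp
  map_smul' c a := by
    classical
    have := finite_arrow G
    let _ := Fintype.ofFinite (Arrow G)
    ext v
    simp only [dStar_apply, Pi.smul_apply, smul_eq_mul, Finset.mul_sum, RingHom.id_apply]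
    refine Finset.sum_congr rfl fun e _ => ?_
    split_ifs <;> simp

theorem dStarLin_apply [Finite V(G)] [Finite E(G)] (a : C1 G ℝ) :
    dStarLin G a = dStar a := rfl

theorem sum_mul_dStar [Fintype V(G)] [Finite E(G)] [Fintype (Arrow G)] (f : C0 G ℝ)
    (a : C1 G ℝ) : ∑ v, f v * dStar a v = (∑ e, (f e.head - f e.tail) * a.1 e) / 2 := by
  have := pairing_dStar f a
  simpa [pairing, d, finsum_eq_sum_of_fintype] using this

theorem mem_H0 [Fintype V(G)] {x : C0 G ℝ} : x ∈ H0 G ↔ ∑ v, x v = 0 := by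
  simp [H0, finsum_eq_sum_of_fintype]

theorem dStar_mem_H0 [Finite V(G)] [Finite E(G)] (a : C1 G ℝ) : dStar a ∈ H0 G := by
  have := finite_arrow G
  let _ := Fintype.ofFinite (Arrow G)
  let _ := Fintype.ofFinite V(G)
  rw [mem_H0]
  simpa using sum_mul_dStar (fun _ => 1) a

end Cochains

/-! ### Cubes as sets of subgradients; tiles are polytopes. -/

section Cube

variable {G : Graph α β} (l : E(G) → ℕ) (m : C1 G ℤ) (f : C0 G ℤ)

/-- The integer `f(v) - f(u) + m_e` for an oriented edge `e = uv`. -/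
def slope (e : Arrow G) : ℤ := f e.head - f e.tail + m.1 e

@[simp] theorem slope_rev (e : Arrow G) : slope m f e.rev = -slope m f e := by
  simp only [slope, C1.map_rev, Arrow.rev_head, Arrow.rev_tail]
  ring

theorem delta_eq (e : Arrow G) : delta l m f e = slope m f e / (l e.edge : ℤ) := by
  rw [delta, Int.floor_div_natCast, Int.floor_intCast]
  rfl

variable {l}

theorem delta_rev_of_dvd {e : Arrow G} (h : (l e.edge : ℤ) ∣ slope m f e) :
    delta l m f e.rev = -delta l m f e := by
  rw [delta_eq, delta_eq, slope_rev, Arrow.rev_edge, Int.neg_ediv_of_dvd h]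

theorem delta_rev_of_not_dvd (hl : ∀ e, 0 < l e) {e : Arrow G}
    (h : ¬ (l e.edge : ℤ) ∣ slope m f e) : delta l m f e.rev = -delta l m f e - 1 := by
  have hl' : (0 : ℤ) < l e.edge := by exact_mod_cast hl e.edge
  rw [delta_eq, delta_eq, slope_rev, Arrow.rev_edge, Int.neg_ediv, if_neg h,
    Int.sign_eq_one_of_pos hl']

theorem mem_integralEdges_iff {e : Arrow G} :
    e.edge.1 ∈ integralEdges l m f ↔ (l e.edge : ℤ) ∣ slope m f e := by
  refine ⟨?_, fun h => ⟨e, rfl, h⟩⟩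
  rintro ⟨e', h1, h2⟩
  rcases Arrow.eq_or_eq_rev (Subtype.ext h1 : e'.edge = e.edge) with rfl | rfl
  · exact h2
  · rw [slope_rev, dvd_neg]
    exact h2

theorem mem_edgeSet_subgraph_iff {e : Arrow G} :
    e.edge.1 ∈ E(subgraph l m f) ↔ (l e.edge : ℤ) ∣ slope m f e := by
  rw [← mem_integralEdges_iff]
  exact ⟨fun h => h.2, fun h => ⟨e.edge.2, h⟩⟩

theorem dPoint_apply (e : Arrow G) :
    (dPoint l m f).1 e = ((delta l m f e : ℝ) - (delta l m f e.rev : ℝ)) / 2 := rfl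

variable {m f}

/-- The bound at the reversed arrow is a lower bound at `e`. If `e` is integral, the two bounds are
𝔡 ± 1/2; otherwise δ_e + δ_ē = -1 and they coincide. The bound itself is the right slope of `phi`,
which links cubes to the energy. -/
theorem mem_cube_iff (hl : ∀ e, 0 < l e) {a : C1 G ℝ} :
    a ∈ cube l m f ↔ ∀ e, a.1 e ≤ delta l m f e + 1 / 2 := by
  constructor
  · rintro ⟨ε, h1, h2, rfl⟩ e
    have h3 := abs_le.1 (h1 e)
    change (dPoint l m f).1 e + ε.1 e ≤ _
    rw [dPoint_apply]
    by_cases h : (l e.edge : ℤ) ∣ slope m f e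
    · rw [delta_rev_of_dvd m f h]
      push_cast
      linarith
    · rw [delta_rev_of_not_dvd m f hl h, h2 e (by rwa [mem_edgeSet_subgraph_iff])]
      push_cast
      linarith
  · intro ha
    have key : ∀ e, (a - dPoint l m f).1 e =
        a.1 e - ((delta l m f e : ℝ) - (delta l m f e.rev : ℝ)) / 2 := fun e => rfl
    refine ⟨a - dPoint l m f, fun e => ?_, fun e he => ?_, by abel⟩
    · have h1 := ha e
      have h2 := ha e.rev
      rw [C1.map_rev] at h2
      rw [abs_le, key]
      by_cases h : (l e.edge : ℤ) ∣ slope m f e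
      · rw [delta_rev_of_dvd m f h] at h2 ⊢
        push_cast at h2 ⊢
        constructor <;> linarith
      · rw [delta_rev_of_not_dvd m f hl h] at h2 ⊢
        push_cast at h2 ⊢
        constructor <;> linarith
    · have h1 := ha e
      have h2 := ha e.rev
      rw [C1.map_rev] at h2
      rw [mem_edgeSet_subgraph_iff] at he
      rw [key]
      rw [delta_rev_of_not_dvd m f hl he] at h2 ⊢
      push_cast at h2 ⊢
      linarith

theorem dPoint_mem_cube (l : E(G) → ℕ) (m : C1 G ℤ) (f : C0 G ℤ) :
    dPoint l m f ∈ cube l m f :=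
  ⟨0, fun e => by simp, fun e _ => rfl, by simp⟩

theorem tile_nonempty (l : E(G) → ℕ) (m : C1 G ℤ) (f : C0 G ℤ) : (tile l m f).Nonempty :=
  ⟨_, _, dPoint_mem_cube l m f, rfl⟩

theorem tile_subset_H0 [Finite V(G)] [Finite E(G)] : tile l m f ⊆ H0 G := by
  rintro _ ⟨a, -, rfl⟩
  exact dStar_mem_H0 a

/-- The antisymmetric part of a function on the arrows. -/
noncomputable def antisymm (G : Graph α β) : (Arrow G → ℝ) →ₗ[ℝ] C1 G ℝ where
  toFun b := ⟨fun e => (b e - b e.rev) / 2, fun e => by simp only [Arrow.rev_rev]; ring⟩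
  map_add' a b := by
    ext e
    simp only [Submodule.coe_add, Pi.add_apply]
    ring
  map_smul' c a := by
    ext e
    simp only [SetLike.val_smul, Pi.smul_apply, smul_eq_mul, RingHom.id_apply]
    ring

-- On all arrows the coordinates are independent, so the cube becomes an affine image of a box,
-- whose vertices are known.
open Classical in
theorem cube_eq_image (l : E(G) → ℕ) (m : C1 G ℤ) (f : C0 G ℤ) :
    cube l m f = dPoint l m f +ᵥ antisymm G '' (Set.univ.pi fun e =>
      Set.Icc (if e.edge.1 ∈ E(subgraph l m f) then -(1 / 2 : ℝ) else 0)
        (if e.edge.1 ∈ E(subgraph l m f) then (1 / 2 : ℝ) else 0)) := by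
  ext a
  constructor
  · rintro ⟨ε, h1, h2, rfl⟩
    refine ⟨ε, ⟨ε.1, fun e _ => ?_, ?_⟩, rfl⟩
    · change _ ∈ Set.Icc _ _
      split_ifs with h
      · exact abs_le.1 (h1 e)
      · simp [h2 e h]
    · ext e
      change (ε.1 e - ε.1 e.rev) / 2 = ε.1 e
      rw [C1.map_rev]
      ring
  · rintro ⟨_, ⟨b, hb, rfl⟩, rfl⟩
    have hb' : ∀ e : Arrow G, (e.edge.1 ∈ E(subgraph l m f) → |b e| ≤ 1 / 2) ∧
        (e.edge.1 ∉ E(subgraph l m f) → b e = 0) := by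
      intro e
      have h1 : b e ∈ Set.Icc _ _ := hb e trivial
      constructor
      · intro h
        rw [if_pos h, if_pos h] at h1
        exact abs_le.2 h1
      · intro h
        rw [if_neg h, if_neg h] at h1
        exact le_antisymm h1.2 h1.1
    refine ⟨_, fun e => ?_, fun e he => ?_, rfl⟩
    · change |(b e - b e.rev) / 2| ≤ 1 / 2
      by_cases h : e.edge.1 ∈ E(subgraph l m f)
      · have h1 := abs_le.1 ((hb' e).1 h)
        have h2 := abs_le.1 ((hb' e.rev).1 h)
        rw [abs_le]
        constructor <;> linarith [h1.1, h1.2, h2.1, h2.2]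
      · simp [(hb' e).2 h, (hb' e.rev).2 h]
    · change (b e - b e.rev) / 2 = 0
      simp [(hb' e).2 he, (hb' e.rev).2 he]

theorem isPolytope_tile [Finite V(G)] [Finite E(G)] (l : E(G) → ℕ) (m : C1 G ℤ)
    (f : C0 G ℤ) : IsPolytope (tile l m f) := by
  classical
  have := finite_arrow G
  let _ := Fintype.ofFinite (Arrow G)
  let S : Set (Arrow G → ℝ) := Set.univ.pi fun e =>
    {if e.edge.1 ∈ E(subgraph l m f) then -(1 / 2 : ℝ) else 0,
      if e.edge.1 ∈ E(subgraph l m f) then (1 / 2 : ℝ) else 0}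
  have hS : S.Finite := Set.Finite.pi fun e => Set.toFinite _
  have hne : S.Nonempty := Set.univ_pi_nonempty_iff.2 fun e => Set.insert_nonempty _ _
  have hconv : (Set.univ.pi fun e : Arrow G =>
      Set.Icc (if e.edge.1 ∈ E(subgraph l m f) then -(1 / 2 : ℝ) else 0)
        (if e.edge.1 ∈ E(subgraph l m f) then (1 / 2 : ℝ) else 0)) = convexHull ℝ S := by
    rw [convexHull_pi]
    congr 1
    ext1 e
    rw [convexHull_pair, segment_eq_Icc]
    split_ifs <;> norm_num
  refine ⟨dStar (dPoint l m f) +ᵥ (dStarLin G ∘ₗ antisymm G) '' S,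
    (hS.image _).vadd_set, (hne.image _).vadd_set, ?_⟩
  rw [convexHull_vadd, ← LinearMap.image_convexHull, ← hconv, tile, cube_eq_image,
    LinearMap.coe_comp, Set.image_comp]
  ext x
  constructor
  · rintro ⟨_, ⟨b, hb, rfl⟩, rfl⟩
    exact ⟨_, ⟨b, hb, rfl⟩, ((dStarLin G).map_add _ _).symm⟩
  · rintro ⟨_, ⟨b, hb, rfl⟩, rfl⟩
    exact ⟨_, ⟨b, hb, rfl⟩, (dStarLin G).map_add _ _⟩

theorem isClosed_tile [Finite V(G)] [Finite E(G)] (l : E(G) → ℕ) (m : C1 G ℤ)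
    (f : C0 G ℤ) : IsClosed (tile l m f) := by
  obtain ⟨s, hs, -, h⟩ := isPolytope_tile l m f
  rw [h]
  exact (hs.isCompact_convexHull ℝ).isClosed

theorem convex_tile [Finite V(G)] [Finite E(G)] (l : E(G) → ℕ) (m : C1 G ℤ)
    (f : C0 G ℤ) : Convex ℝ (tile l m f) := by
  obtain ⟨s, -, -, h⟩ := isPolytope_tile l m f
  rw [h]
  exact convex_convexHull ℝ s

end Cube

/-! ### Cut conditions imply inequalities for all potentials. -/

section LayerCake

open Classical in
/-- A cut condition for a flow on a finite digraph implies the corresponding inequality for all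
potentials. -/
theorem sum_mul_le_of_cuts {V A : Type*} [Fintype V] [Fintype A] (h t : A → V) (u : A → ℝ)
    (x : V → ℝ) (hx : ∑ v, x v = 0)
    (hcut : ∀ S : Set V, ∑ v, (if v ∈ S then x v else 0) ≤
      ∑ e, if h e ∈ S ∧ t e ∉ S then u e else 0) (g : V → ℝ) :
    ∑ v, g v * x v ≤ ∑ e, max (g (h e) - g (t e)) 0 * u e := by
  induction hn : (Finset.univ.image g).card using Nat.strong_induction_on generalizing g with
  | _ n ih =>
  rcases isEmpty_or_nonempty V with hV | hV
  · have : IsEmpty A := ⟨fun a => hV.elim (h a)⟩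
    simp
  obtain ⟨v₀, hv₀⟩ := Finite.exists_min g
  rcases (Finset.univ.filter fun v => g v₀ < g v).eq_empty_or_nonempty with hT | hT
  · have hconst : ∀ v, g v = g v₀ := by
      intro v
      refine le_antisymm (not_lt.1 fun hlt => ?_) (hv₀ v)
      have : v ∈ Finset.univ.filter fun v => g v₀ < g v := by simp [hlt]
      simp [hT] at this
    simp only [hconst, ← Finset.mul_sum, hx]
    simp
  obtain ⟨v₁, hv₁, hmin⟩ := Finset.exists_min_image _ g hT
  simp only [Finset.mem_filter, Finset.mem_univ, true_and] at hv₁ hmin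
  -- Merge the two lowest levels of `g`. Up to a constant, which pairs to zero with `x`, `g` is `g'`
  -- plus a nonnegative multiple of the indicator of `S`, and `g'` takes fewer values.
  set g' : V → ℝ := fun v => max (g v) (g v₁) with hg'
  set S : Set V := {v | g v₀ < g v} with hS
  have hsplit : ∀ v, g v = (g v₁ - g v₀) * (if v ∈ S then 1 else 0) + g' v - (g v₁ - g v₀) := by
    intro v
    by_cases hv : g v₀ < g v
    · have : v ∈ S := hv
      simp [this, hg', max_eq_left (hmin v hv)]
    · have h1 : v ∉ S := hv
      have h2 : g v = g v₀ := le_antisymm (not_lt.1 hv) (hv₀ v)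
      simp [h1, hg', h2, hv₁.le]
  have hlt : (Finset.univ.image g').card < n := by
    rw [← hn]
    refine Finset.card_lt_card ⟨?_, fun hsub => ?_⟩
    · intro y hy
      simp only [Finset.mem_image, Finset.mem_univ, true_and] at hy ⊢
      obtain ⟨v, rfl⟩ := hy
      rcases le_total (g v) (g v₁) with h' | h'
      · exact ⟨v₁, by simp [hg', h']⟩
      · exact ⟨v, by simp [hg', h']⟩
    · have : g v₀ ∈ Finset.univ.image g' := hsub (Finset.mem_image_of_mem g (Finset.mem_univ _))
      simp only [Finset.mem_image, Finset.mem_univ, true_and] at this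
      obtain ⟨v, hv⟩ := this
      have : g v₁ ≤ g' v := le_max_right _ _
      linarith
  have h1 := ih _ hlt g' rfl
  have h2 := mul_le_mul_of_nonneg_left (hcut S) (sub_nonneg.2 hv₁.le)
  have h3 : ∑ v, g v * x v = (g v₁ - g v₀) * (∑ v, if v ∈ S then x v else 0) +
      ∑ v, g' v * x v := by
    have : ∑ v, g v * x v = ∑ v, ((g v₁ - g v₀) * (if v ∈ S then x v else 0) + g' v * x v -
        (g v₁ - g v₀) * x v) := by
      refine Finset.sum_congr rfl fun v _ => ?_
      conv_lhs => rw [hsplit v]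
      split_ifs <;> ring
    rw [this, Finset.sum_sub_distrib, Finset.sum_add_distrib, ← Finset.mul_sum,
      ← Finset.mul_sum, hx]
    ring
  have h4 : ∑ e, max (g (h e) - g (t e)) 0 * u e =
      (g v₁ - g v₀) * (∑ e, if h e ∈ S ∧ t e ∉ S then u e else 0) +
      ∑ e, max (g' (h e) - g' (t e)) 0 * u e := by
    rw [Finset.mul_sum, ← Finset.sum_add_distrib]
    refine Finset.sum_congr rfl fun e _ => ?_
    have mem : ∀ v, v ∈ S → g' v = g v ∧ g v₁ ≤ g v := fun v hv =>
      ⟨max_eq_left (hmin v hv), hmin v hv⟩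
    have nmem : ∀ v, v ∉ S → g' v = g v₁ ∧ g v = g v₀ := fun v hv =>
      ⟨max_eq_right ((not_lt.1 hv).trans hv₁.le), le_antisymm (not_lt.1 hv) (hv₀ v)⟩
    by_cases hh : h e ∈ S <;> by_cases ht : t e ∈ S
    · rw [if_neg (by tauto), (mem _ hh).1, (mem _ ht).1]
      ring
    · rw [if_pos ⟨hh, ht⟩, (mem _ hh).1, (nmem _ ht).1, (nmem _ ht).2,
        max_eq_left (by linarith [(mem _ hh).2]), max_eq_left (by linarith [(mem _ hh).2])]
      ring
    · rw [if_neg (by tauto), (nmem _ hh).1, (nmem _ hh).2, (mem _ ht).1,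
        max_eq_right (by linarith [(mem _ ht).2]), max_eq_right (by linarith [(mem _ ht).2])]
      ring
    · rw [if_neg (by tauto), (nmem _ hh).1, (nmem _ hh).2, (nmem _ ht).1, (nmem _ ht).2]
      simp
  linarith

end LayerCake

/-! ### The energy and its subdifferentials. -/

section Energy

variable {G : Graph α β}

/-- The potential whose subdifferential at `f` is the tile of `f`. -/
noncomputable def energy (l : E(G) → ℕ) (m : C1 G ℤ) (f : C0 G ℤ) : ℝ :=
  (∑ᶠ e, phi (l e.edge) (slope m f e)) / 2

theorem energy_eq [Fintype (Arrow G)] (l : E(G) → ℕ) (m : C1 G ℤ) (f : C0 G ℤ) :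
    energy l m f = (∑ e, phi (l e.edge) (slope m f e)) / 2 := by
  rw [energy, finsum_eq_sum_of_fintype]

variable {l : E(G) → ℕ} {m : C1 G ℤ} {f g : C0 G ℤ} {a : C1 G ℝ}

theorem sum_sub_mul_dStar [Fintype V(G)] [Finite E(G)] [Fintype (Arrow G)] (m : C1 G ℤ)
    (f g : C0 G ℤ) (a : C1 G ℝ) : ∑ v, ((g v : ℝ) - f v) * dStar a v =
      (∑ e, a.1 e * ((slope m g e : ℝ) - slope m f e)) / 2 := by
  rw [sum_mul_dStar (fun v => (g v : ℝ) - f v) a]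
  congr 1
  refine Finset.sum_congr rfl fun e _ => ?_
  simp only [slope]
  push_cast
  ring

theorem cube_bounds (hl : ∀ e, 0 < l e) (ha : a ∈ cube l m f) (e : Arrow G) :
    a.1 e ≤ ((slope m f e / (l e.edge : ℤ) : ℤ) : ℝ) + 1 / 2 ∧
      -a.1 e ≤ ((-slope m f e / (l e.edge : ℤ) : ℤ) : ℝ) + 1 / 2 := by
  rw [mem_cube_iff hl] at ha
  constructor
  · rw [← delta_eq]
    exact ha e
  · have := ha e.rev
    rwa [C1.map_rev, delta_eq, slope_rev, Arrow.rev_edge] at this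

/-- The subgradient inequality. -/
theorem energy_add_le [Fintype V(G)] [Finite E(G)] (hl : ∀ e, 0 < l e) (ha : a ∈ cube l m f)
    (g : C0 G ℤ) :
    energy l m f + ∑ v, ((g v : ℝ) - f v) * dStar a v ≤ energy l m g := by
  have := finite_arrow G
  let _ := Fintype.ofFinite (Arrow G)
  rw [energy_eq, energy_eq, sum_sub_mul_dStar m, ← add_div, ← Finset.sum_add_distrib]
  gcongr with e
  exact phi_add_mul_le (hl _) _ (cube_bounds hl ha e).1 (cube_bounds hl ha e).2

/-- Equality of the sums forces equality on each arrow, and a supporting line of a convex function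
at one point supports it wherever they touch. -/
theorem mem_cube_of_energy_eq [Fintype V(G)] [Finite E(G)] (hl : ∀ e, 0 < l e)
    (ha : a ∈ cube l m f)
    (h : energy l m f + ∑ v, ((g v : ℝ) - f v) * dStar a v = energy l m g) :
    a ∈ cube l m g := by
  have := finite_arrow G
  let _ := Fintype.ofFinite (Arrow G)
  rw [energy_eq, energy_eq, sum_sub_mul_dStar m, ← add_div, ← Finset.sum_add_distrib,
    div_left_inj' two_ne_zero, Finset.sum_eq_sum_iff_of_le fun e _ =>
      phi_add_mul_le (hl _) _ (cube_bounds hl ha e).1 (cube_bounds hl ha e).2] at h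
  rw [mem_cube_iff hl]
  intro e
  rw [delta_eq]
  exact le_of_phi_add_mul_eq (hl _) (cube_bounds hl ha e).1 (cube_bounds hl ha e).2
    (h e (Finset.mem_univ e))

/-- The functional given by the scalar product with `g`. -/
noncomputable def dual [Fintype V(G)] (g : C0 G ℝ) : StrongDual ℝ (C0 G ℝ) :=
  ∑ v, g v • ContinuousLinearMap.proj v

theorem dual_apply [Fintype V(G)] (g x : C0 G ℝ) : dual g x = ∑ v, g v * x v := by
  simp [dual]

theorem exists_eq_dual [Fintype V(G)] (L : StrongDual ℝ (C0 G ℝ)) : ∃ g, L = dual g := by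
  classical
  refine ⟨fun v => L (Pi.single v 1), ?_⟩
  ext x
  rw [dual_apply]
  have : x = ∑ v, x v • (Pi.single v (1 : ℝ) : C0 G ℝ) := by
    ext w
    simp [Finset.sum_apply, Pi.single_apply]
  conv_lhs => rw [this, map_sum]
  exact Finset.sum_congr rfl fun v _ => by rw [map_smul, smul_eq_mul, mul_comm]

/-- Two tiles meet in a common face. -/
theorem isFace_tile_inter [Finite V(G)] [Finite E(G)] (hl : ∀ e, 0 < l e)
    (h : (tile l m f ∩ tile l m g).Nonempty) :
    IsFace (tile l m f) (tile l m f ∩ tile l m g) := by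
  let _ := Fintype.ofFinite V(G)
  have le : ∀ f g, ∀ x ∈ tile l m f,
      energy l m f + ∑ v, ((g v : ℝ) - f v) * x v ≤ energy l m g := by
    rintro f g _ ⟨a, ha, rfl⟩
    exact energy_add_le hl ha g
  have eq : ∀ x ∈ tile l m f ∩ tile l m g,
      energy l m f + ∑ v, ((g v : ℝ) - f v) * x v = energy l m g := by
    intro x hx
    refine le_antisymm (le f g x hx.1) ?_
    have := le g f x hx.2
    have h2 : ∑ v, ((f v : ℝ) - g v) * x v = -∑ v, ((g v : ℝ) - f v) * x v := by
      rw [← Finset.sum_neg_distrib]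
      exact Finset.sum_congr rfl fun v _ => by ring
    linarith
  -- On the tile of `f` this functional is at most E(g) - E(f), with equality exactly on the tile of
  -- `g`.
  refine ⟨h, fun _ => ⟨dual fun v => (g v : ℝ) - f v, ?_⟩⟩
  obtain ⟨z, hz⟩ := h
  ext x
  simp only [dual_apply]
  constructor
  · intro hx
    refine ⟨hx.1, fun y hy => ?_⟩
    have := le f g y hy
    have := eq x hx
    linarith
  · rintro ⟨hx, hm⟩
    refine ⟨hx, ?_⟩
    have h1 := le f g x hx
    have h2 := eq z hz
    have h3 := hm z hz.1
    obtain ⟨a, ha, rfl⟩ := hx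
    exact ⟨a, mem_cube_of_energy_eq hl ha (by linarith), rfl⟩

open Classical in
/-- The integral indicator function of a set of vertices. -/
noncomputable def ind (S : Set V(G)) : C0 G ℤ := fun v => if v ∈ S then 1 else 0

/-- Says that the interval of subgradients, from -(δ_ē + 1/2) to δ_e + 1/2, is nonempty. -/
theorem delta_add_delta_rev (hl : ∀ e, 0 < l e) (e : Arrow G) :
    (-1 : ℝ) ≤ (delta l m f e : ℝ) + delta l m f e.rev := by
  by_cases h : (l e.edge : ℤ) ∣ slope m f e
  · rw [delta_rev_of_dvd m f h]
    push_cast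
    linarith
  · rw [delta_rev_of_not_dvd m f hl h]
    push_cast
    linarith

-- Slopes change by at most one, so `phi_succ` gives the exact increment. Each crossing edge is
-- counted in both orientations, which cancels the factor 1/2 in the energy.
open Classical in
theorem energy_add_ind [Fintype (Arrow G)] (hl : ∀ e, 0 < l e) (S : Set V(G)) :
    energy l m (f + ind S) = energy l m f +
      ∑ e : Arrow G, if e.head ∈ S ∧ e.tail ∉ S then (delta l m f e : ℝ) + 1 / 2 else 0 := by
  set F : Arrow G → ℝ := fun e =>
    if e.head ∈ S ∧ e.tail ∉ S then (delta l m f e : ℝ) + 1 / 2 else 0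
  have key : ∀ e : Arrow G, phi (l e.edge) (slope m (f + ind S) e) =
      phi (l e.edge) (slope m f e) + (F e + F e.rev) := by
    intro e
    simp only [F, Arrow.rev_head, Arrow.rev_tail]
    have hs : slope m (f + ind S) e = slope m f e + (ind S e.head - ind S e.tail) := by
      simp only [slope, Pi.add_apply]
      ring
    rw [hs]
    by_cases hh : e.head ∈ S <;> by_cases ht : e.tail ∈ S
    · simp [ind, hh, ht]
    · have : slope m f e + (ind S e.head - ind S e.tail) = slope m f e + 1 := by
        simp [ind, hh, ht]
      rw [this, phi_succ (hl _), delta_eq]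
      simp [hh, ht]
    · have : slope m f e + (ind S e.head - ind S e.tail) = -(-slope m f e + 1) := by
        simp only [ind, hh, ht, if_true, if_false]
        ring
      rw [this, phi_neg (hl _), phi_succ (hl _), phi_neg (hl _), delta_eq, delta_eq, slope_rev]
      simp [hh, ht]
    · simp [ind, hh, ht]
  rw [energy_eq, energy_eq, Finset.sum_congr rfl fun e _ => key e, Finset.sum_add_distrib,
    Finset.sum_add_distrib, sum_rev F]
  ring

/-- The tile of `f` is the subdifferential of the energy at `f`. -/
theorem mem_tile_iff [Fintype V(G)] [Finite E(G)] (hl : ∀ e, 0 < l e) {x : C0 G ℝ} :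
    x ∈ tile l m f ↔ x ∈ H0 G ∧
      ∀ g, energy l m f + ∑ v, ((g v : ℝ) - f v) * x v ≤ energy l m g := by
  classical
  have := finite_arrow G
  let _ := Fintype.ofFinite (Arrow G)
  constructor
  · rintro ⟨a, ha, rfl⟩
    exact ⟨dStar_mem_H0 a, energy_add_le hl ha⟩
  rintro ⟨hx0, hx⟩
  by_contra hxt
  obtain ⟨L, r, hL1, hL2⟩ :=
    geometric_hahn_banach_closed_point (convex_tile l m f) (isClosed_tile l m f) hxt
  obtain ⟨g, rfl⟩ := exists_eq_dual L
  set u : Arrow G → ℝ := fun e => (delta l m f e : ℝ) + 1 / 2 with hu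
  -- Testing the hypothesis on `f + ind S` yields the cut condition for `S`.
  have hcake := sum_mul_le_of_cuts Arrow.head Arrow.tail u x (mem_H0.1 hx0) (fun S => by
    have h1 := hx (f + ind S)
    rw [energy_add_ind hl] at h1
    refine le_trans (le_of_eq ?_) (le_of_add_le_add_left h1)
    refine Finset.sum_congr rfl fun v _ => ?_
    by_cases hv : v ∈ S <;> simp [ind, hv]) g
  -- The point of the cube that maximises the pairing with `d g`: extreme where `g` varies,
  -- arbitrary where it is constant. Its pairing equals the bound in `hcake`, against the
  -- separation.
  set c : Arrow G → ℝ := fun e => if g e.tail < g e.head then u e else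
    if g e.head < g e.tail then -u e.rev else (dPoint l m f).1 e with hc
  have hcr : ∀ e, c e.rev = -c e := by
    intro e
    simp only [hc, Arrow.rev_head, Arrow.rev_tail, C1.map_rev, Arrow.rev_rev]
    rcases lt_trichotomy (g e.tail) (g e.head) with h | h | h
    · simp [h, h.not_gt]
    · simp [h]
    · simp [h, h.not_gt]
  let a : C1 G ℝ := ⟨c, hcr⟩
  have ha : a ∈ cube l m f := by
    rw [mem_cube_iff hl]
    intro e
    change c e ≤ u e
    have := delta_add_delta_rev (m := m) (f := f) hl e
    simp only [hc, hu]
    split_ifs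
    · exact le_rfl
    · linarith
    · rw [dPoint_apply]
      linarith
  have h1 := hL1 _ ⟨a, ha, rfl⟩
  rw [dual_apply] at h1 hL2
  rw [sum_mul_dStar] at h1
  have h2 : ∑ e : Arrow G, (g e.head - g e.tail) * a.1 e =
      ∑ e : Arrow G, (max (g e.head - g e.tail) 0 * u e +
        max (g e.rev.head - g e.rev.tail) 0 * u e.rev) := by
    refine Finset.sum_congr rfl fun e _ => ?_
    change _ * c e = _
    simp only [hc, Arrow.rev_head, Arrow.rev_tail]
    rcases lt_trichotomy (g e.tail) (g e.head) with h | h | h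
    · rw [if_pos h, max_eq_left (by linarith), max_eq_right (by linarith)]
      ring
    · simp [h]
    · rw [if_neg h.not_gt, if_pos h, max_eq_right (by linarith), max_eq_left (by linarith)]
      ring
  rw [h2, Finset.sum_add_distrib,
    sum_rev fun e : Arrow G => max (g e.head - g e.tail) 0 * u e] at h1
  linarith

end Energy

section

variable {G : Graph α β}

/-! ### Connectedness and surjectivity of d* onto H₀. -/

section Connected

theorem IsConnected.nonempty (hG : IsConnected G) : Nonempty V(G) :=
  SimpleGraph.Connected.nonempty hG

theorem Arrow.of_adj {u v : V(G)} (h : G.toSimpleGraph.Adj u v) :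
    ∃ e : Arrow G, e.tail = u ∧ e.head = v := by
  rw [Graph.toSimpleGraph_adj] at h
  obtain ⟨b, hb⟩ := h.2
  exact ⟨⟨⟨b, hb.edge_mem⟩, u, v, hb⟩, rfl, rfl⟩

/-- A property of vertices of a connected graph that propagates along arrows holds everywhere if
it holds somewhere. -/
theorem IsConnected.induction (hG : IsConnected G) {p : V(G) → Prop} {u : V(G)} (hu : p u)
    (h : ∀ e : Arrow G, p e.tail → p e.head) (v : V(G)) : p v := by
  obtain ⟨w⟩ := SimpleGraph.Connected.preconnected hG u v
  induction w with
  | nil => exact hu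
  | cons hadj _ ih =>
    obtain ⟨e, rfl, rfl⟩ := Arrow.of_adj hadj
    exact ih (h e hu)

theorem isConnected_of_cut (hne : Nonempty V(G)) (h : ∀ (S : Set V(G)) (u v : V(G)), u ∈ S →
    v ∉ S → ∃ e : Arrow G, e.tail ∈ S ∧ e.head ∉ S) : IsConnected G := by
  refine (SimpleGraph.connected_iff _).2 ⟨fun u v => ?_, hne⟩
  by_contra hv
  obtain ⟨e, h1, h2⟩ := h {w | G.toSimpleGraph.Reachable u w} u v (SimpleGraph.Reachable.refl u) hv
  refine h2 (SimpleGraph.Reachable.trans h1 (SimpleGraph.Adj.reachable ?_))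
  rw [Graph.toSimpleGraph_adj]
  refine ⟨fun h => h2 (h ▸ h1), _, e.isLink⟩

open Classical in
/-- The differences of ends of arrows of a connected graph generate the functions of sum zero. -/
theorem IsConnected.mem_of_mem_H0 [Fintype V(G)] (hG : IsConnected G)
    {N : Submodule ℝ (C0 G ℝ)}
    (hN : ∀ e : Arrow G, (Pi.single e.head 1 - Pi.single e.tail 1 : C0 G ℝ) ∈ N)
    {x : C0 G ℝ} (hx : x ∈ H0 G) : x ∈ N := by
  obtain ⟨v₀⟩ := hG.nonempty
  have h1 : ∀ v, (Pi.single v 1 - Pi.single v₀ 1 : C0 G ℝ) ∈ N := by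
    refine hG.induction (u := v₀) (by simp) fun e he => ?_
    have := N.add_mem (hN e) he
    simpa using this
  have h2 : x = ∑ v, x v • (Pi.single v 1 - Pi.single v₀ 1 : C0 G ℝ) := by
    ext w
    have h3 : ∑ v, x v * (Pi.single v₀ 1 : C0 G ℝ) w = 0 := by
      rw [← Finset.sum_mul, mem_H0.1 hx, zero_mul]
    simp only [Finset.sum_apply, Pi.smul_apply, Pi.sub_apply, smul_eq_mul, mul_sub,
      Finset.sum_sub_distrib, h3]
    simp [Pi.single_apply]
  rw [h2]
  exact N.sum_mem fun v _ => N.smul_mem _ (h1 v)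

open Classical in
theorem dStar_antisymm_single [Finite V(G)] [Finite E(G)] (e : Arrow G) :
    dStar (antisymm G (Pi.single e 1)) =
      (1 / 2 : ℝ) • (Pi.single e.head 1 - Pi.single e.tail 1 : C0 G ℝ) := by
  have := finite_arrow G
  let _ := Fintype.ofFinite (Arrow G)
  ext v
  rw [dStar_apply]
  have h1 : ∀ e' : Arrow G, (if e'.head = v then (antisymm G (Pi.single e 1)).1 e' else 0) =
      (1 / 2) * ((if e'.head = v then (Pi.single e 1 : Arrow G → ℝ) e' else 0) -
        (if e'.rev.tail = v then (Pi.single e 1 : Arrow G → ℝ) e'.rev else 0)) := by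
    intro e'
    change (if e'.head = v then ((Pi.single e 1 : Arrow G → ℝ) e' -
      (Pi.single e 1 : Arrow G → ℝ) e'.rev) / 2 else 0) = _
    rw [Arrow.rev_tail]
    split_ifs <;> ring
  have h2 : ∀ p : Arrow G → V(G),
      ∑ e', (if p e' = v then (Pi.single e 1 : Arrow G → ℝ) e' else 0) =
        if p e = v then 1 else 0 := by
    intro p
    rw [Finset.sum_eq_single e]
    · simp
    · intro b _ hb
      simp [hb]
    · simp
  rw [Finset.sum_congr rfl fun e' _ => h1 e', ← Finset.mul_sum, Finset.sum_sub_distrib,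
    sum_rev fun e' : Arrow G => if e'.tail = v then (Pi.single e 1 : Arrow G → ℝ) e' else 0,
    h2, h2]
  simp [Pi.single_apply, eq_comm]

theorem IsConnected.exists_dStar_eq [Finite V(G)] [Finite E(G)] (hG : IsConnected G)
    {x : C0 G ℝ} (hx : x ∈ H0 G) : ∃ a : C1 G ℝ, dStar a = x := by
  classical
  let _ := Fintype.ofFinite V(G)
  have : x ∈ LinearMap.range (dStarLin G) := by
    refine hG.mem_of_mem_H0 (fun e => ?_) hx
    refine ⟨(2 : ℝ) • antisymm G (Pi.single e 1), ?_⟩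
    rw [map_smul, dStarLin_apply, dStar_antisymm_single, smul_smul]
    norm_num
  exact this

end Connected

/-! ### The tiles with connected graphs cover H₀. -/

section Cover

/-- Coercivity: `phi l` has affine minorants of slope at least a + 1 and at most a - 1. -/
theorem exists_abs_sub_le_phi {l : ℕ} (hl : 0 < l) (a : ℝ) :
    ∃ C : ℝ, ∀ t : ℤ, |(t : ℝ)| - C ≤ phi l t - a * t := by
  have hj : (a + 1 : ℝ) ≤ ⌈a + 1⌉ := Int.le_ceil _
  have hk : (⌊a - 1⌋ : ℝ) ≤ a - 1 := Int.floor_le _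
  set j : ℤ := ⌈a + 1⌉
  -- The extra -1 absorbs the 1/2 in the slope k + 1/2.
  set k : ℤ := ⌊a - 1⌋ - 1 with hk'
  have hk2 : (k : ℝ) = ⌊a - 1⌋ - 1 := by simp [hk']
  refine ⟨max (l * j * (j + 1) / 2) (l * k * (k + 1) / 2), fun t => ?_⟩
  have h1 := le_phi hl t j
  have h2 := le_phi hl t k
  have h3 := le_max_left ((l : ℝ) * j * (j + 1) / 2) (l * k * (k + 1) / 2)
  have h4 := le_max_right ((l : ℝ) * j * (j + 1) / 2) (l * k * (k + 1) / 2)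
  rcases le_total (0 : ℝ) t with ht | ht
  · rw [abs_of_nonneg ht]
    nlinarith [mul_nonneg ht (sub_nonneg.2 hj)]
  · rw [abs_of_nonpos ht]
    have : 0 ≤ a - 1 - 1 / 2 - (k : ℝ) := by linarith
    nlinarith [mul_nonneg (neg_nonneg.2 ht) this]

variable {l : E(G) → ℕ} (m : C1 G ℤ)

/-- The energy tilted by a function of sum zero attains its minimum on integral functions. -/
theorem IsConnected.exists_min_energy [Fintype V(G)] [Finite E(G)] (hG : IsConnected G)
    (hl : ∀ e, 0 < l e) {x : C0 G ℝ} (hx : x ∈ H0 G) :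
    ∃ f : C0 G ℤ, ∀ g : C0 G ℤ,
      energy l m f - ∑ v, (f v : ℝ) * x v ≤ energy l m g - ∑ v, (g v : ℝ) * x v := by
  have := finite_arrow G
  let _ := Fintype.ofFinite (Arrow G)
  obtain ⟨v₀⟩ := hG.nonempty
  obtain ⟨a, rfl⟩ := hG.exists_dStar_eq hx
  set F : C0 G ℤ → ℝ := fun f => energy l m f - ∑ v, (f v : ℝ) * dStar a v with hF
  -- Constants do not matter because `dStar a` has sum zero. Normalised at `v₀`, the sublevel set is
  -- finite: slopes are bounded, and bounds spread from `v₀` along arrows.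
  have hshift : ∀ f : C0 G ℤ, F (fun v => f v - f v₀) = F f := by
    intro f
    have h1 : ∀ e, slope m (fun v => f v - f v₀) e = slope m f e := fun e => by
      simp [slope]
    simp only [hF, energy_eq, h1]
    push_cast
    simp only [sub_mul, Finset.sum_sub_distrib, ← Finset.mul_sum, mem_H0.1 (dStar_mem_H0 a)]
    ring
  choose C hC using fun e : Arrow G => exists_abs_sub_le_phi (hl e.edge) (a.1 e)
  have hlow : ∀ f, (∑ e, (|(slope m f e : ℝ)| - C e + a.1 e * m.1 e)) / 2 ≤ F f := by
    intro f
    simp only [hF]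
    rw [energy_eq, sum_mul_dStar (fun v => (f v : ℝ)) a, ← sub_div, ← Finset.sum_sub_distrib]
    gcongr with e
    have h1 := hC e (slope m f e)
    have h2 : ((f e.head : ℝ) - f e.tail) = slope m f e - m.1 e := by
      simp only [slope]
      push_cast
      ring
    rw [h2]
    linarith
  set T : Set (C0 G ℤ) := {f | f v₀ = 0 ∧ F f ≤ F 0} with hT
  set K : ℝ := 2 * F 0 + ∑ e, (C e - a.1 e * m.1 e) with hK
  have hbound : ∀ f ∈ T, ∀ e, |(slope m f e : ℝ)| ≤ K := by
    intro f hf e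
    have h1 := (hlow f).trans hf.2
    have h2 : ∑ e, |(slope m f e : ℝ)| ≤ K := by
      have : ∑ e, |(slope m f e : ℝ)| = ∑ e, (|(slope m f e : ℝ)| - C e + a.1 e * m.1 e) +
          ∑ e, (C e - a.1 e * m.1 e) := by
        rw [← Finset.sum_add_distrib]
        exact Finset.sum_congr rfl fun e _ => by ring
      linarith
    exact (Finset.single_le_sum (f := fun e => |(slope m f e : ℝ)|) (fun _ _ => abs_nonneg _)
      (Finset.mem_univ e)).trans h2
  have hfin : ∀ v, ∃ B : ℝ, ∀ f ∈ T, |(f v : ℝ)| ≤ B := by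
    refine hG.induction (u := v₀) ⟨0, fun f hf => by simp [hf.1]⟩ fun e he => ?_
    obtain ⟨B, hB⟩ := he
    refine ⟨B + K + |(m.1 e : ℝ)|, fun f hf => ?_⟩
    have h1 := hB f hf
    have h2 := hbound f hf e
    have h3 : (f e.head : ℝ) = f e.tail + slope m f e - m.1 e := by
      simp only [slope]
      push_cast
      ring
    rw [h3]
    have h4 := abs_sub ((f e.tail : ℝ) + slope m f e) (m.1 e)
    have h5 := abs_add_le (f e.tail : ℝ) (slope m f e)
    linarith
  choose B hB using hfin
  have hTfin : T.Finite := by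
    refine (Set.Finite.pi fun v => Set.finite_Icc (-⌊B v⌋) ⌊B v⌋).subset fun f hf v _ => ?_
    have h1 : ((|f v| : ℤ) : ℝ) ≤ B v := by
      push_cast
      exact hB v f hf
    exact abs_le.1 (Int.le_floor.2 h1)
  obtain ⟨f, hf, hmin⟩ := Set.exists_min_image T F hTfin ⟨0, rfl, le_rfl⟩
  refine ⟨f, fun g => ?_⟩
  change F f ≤ F g
  rw [← hshift g]
  rcases le_total (F fun v => g v - g v₀) (F 0) with h | h
  · exact hmin _ ⟨by simp, h⟩
  · exact hf.2.trans h

theorem IsConnected.exists_mem_tile [Finite V(G)] [Finite E(G)] (hG : IsConnected G)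
    (hl : ∀ e, 0 < l e) {x : C0 G ℝ} (hx : x ∈ H0 G) : ∃ f : C0 G ℤ, x ∈ tile l m f := by
  let _ := Fintype.ofFinite V(G)
  obtain ⟨f, hf⟩ := hG.exists_min_energy m hl hx
  refine ⟨f, (mem_tile_iff hl).2 ⟨hx, fun g => ?_⟩⟩
  have := hf g
  simp only [sub_mul, Finset.sum_sub_distrib]
  linarith

variable {m} {f : C0 G ℤ}

/-- The cube of `f` only grows when `f` is raised by one on a set without integral edges in its
boundary. -/
theorem cube_subset_cube_add_ind (hl : ∀ e, 0 < l e) {S : Set V(G)}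
    (hS : ∀ e : Arrow G, e.head ∈ S → e.tail ∉ S → ¬ (l e.edge : ℤ) ∣ slope m f e) :
    cube l m f ⊆ cube l m (f + ind S) := by
  intro a ha
  rw [mem_cube_iff hl] at ha ⊢
  intro e
  refine (ha e).trans ?_
  have hpos : (0 : ℤ) < l e.edge := by exact_mod_cast hl e.edge
  have hs : slope m (f + ind S) e = slope m f e + (ind S e.head - ind S e.tail) := by
    simp only [slope, Pi.add_apply]
    ring
  have key : slope m f e / (l e.edge : ℤ) ≤ slope m (f + ind S) e / (l e.edge : ℤ) := by
    rw [hs]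
    by_cases hh : e.head ∈ S <;> by_cases ht : e.tail ∈ S
    · simp [ind, hh, ht]
    · exact Int.ediv_le_ediv hpos (by simp [ind, hh, ht])
    · have h1 := hS e.rev ht hh
      rw [slope_rev, dvd_neg, Arrow.rev_edge] at h1
      simp only [ind, hh, ht, if_true, if_false]
      -- The slope drops by one here, but as it is not a multiple of the length its floor quotient
      -- does not drop.
      rw [Int.le_ediv_iff_mul_le hpos]
      have h2 := Int.ediv_mul_le (slope m f e) hpos.ne'
      have h3 : slope m f e / (l e.edge : ℤ) * l e.edge ≠ slope m f e :=
        fun h => h1 ⟨_, by rw [mul_comm, h]⟩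
      lia
    · simp [ind, hh, ht]
  rw [delta_eq, delta_eq]
  have : ((slope m f e / (l e.edge : ℤ) : ℤ) : ℝ) ≤
    ((slope m (f + ind S) e / (l e.edge : ℤ) : ℤ) : ℝ) := by exact_mod_cast key
  linarith

/-- If the graph of `f` is disconnected, then its cube is contained in a cube with more integral
edges. -/
theorem exists_cube_supset (hG : IsConnected G) (hl : ∀ e, 0 < l e)
    (hf : ¬ IsConnected (subgraph l m f)) :
    ∃ g : C0 G ℤ, cube l m f ⊆ cube l m g ∧ integralEdges l m f ⊂ integralEdges l m g := by
  classical
  obtain ⟨S, u, v, hu, hv, hS⟩ : ∃ (S : Set V(G)) (u v : V(G)), u ∈ S ∧ v ∉ S ∧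
      ∀ e : Arrow G, e.head ∈ S → e.tail ∉ S → ¬ (l e.edge : ℤ) ∣ slope m f e := by
    by_contra hcon
    push Not at hcon
    refine hf (isConnected_of_cut hG.nonempty fun S u v hu hv => ?_)
    obtain ⟨e, h1, h2, h3⟩ := hcon S u v hu hv
    rw [← mem_integralEdges_iff] at h3
    exact ⟨⟨⟨e.edge.1, e.edge.2, h3⟩, e.head, e.tail, h3, e.isLink.symm⟩, h1, h2⟩
  have hslope : ∀ (k : ℕ) (e : Arrow G), slope m (f + k • ind S) e =
      slope m f e + k * (ind S e.head - ind S e.tail) := by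
    intro k e
    simp only [slope, Pi.add_apply, Pi.smul_apply]
    simp only [nsmul_eq_mul]
    ring
  obtain ⟨e₀, h1, h2⟩ : ∃ e : Arrow G, e.tail ∉ S ∧ e.head ∈ S := by
    by_contra hcon
    push Not at hcon
    exact hG.induction (p := fun w => w ∉ S) hv hcon u hu
  have hex : ∃ k : ℕ, ∃ e : Arrow G, e.head ∈ S ∧ e.tail ∉ S ∧
      (l e.edge : ℤ) ∣ slope m (f + k • ind S) e := by
    have hpos : (0 : ℤ) < l e₀.edge := by exact_mod_cast hl e₀.edge
    -- Each unit raise adds one to the slope of `e₀`, so this residue reaches a multiple of the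
    -- length.
    refine ⟨((-slope m f e₀) % (l e₀.edge : ℤ)).toNat, e₀, h2, h1, ?_⟩
    rw [hslope, Int.toNat_of_nonneg (Int.emod_nonneg _ hpos.ne')]
    simp only [ind, h1, h2, if_true, if_false]
    have := Int.emod_add_mul_ediv (-slope m f e₀) (l e₀.edge : ℤ)
    refine ⟨-(-slope m f e₀ / (l e₀.edge : ℤ)), ?_⟩
    linarith
  have hsub : ∀ j ≤ Nat.find hex, cube l m f ⊆ cube l m (f + j • ind S) := by
    intro j
    induction j with
    | zero => intro _; simp
    | succ j ih =>
      intro hj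
      refine (ih (by lia)).trans ?_
      rw [succ_nsmul, ← add_assoc]
      refine cube_subset_cube_add_ind hl fun e he1 he2 he3 => ?_
      exact Nat.find_min hex (m := j) (by lia) ⟨e, he1, he2, he3⟩
  obtain ⟨e, he1, he2, he3⟩ := Nat.find_spec hex
  refine ⟨f + Nat.find hex • ind S, hsub _ le_rfl, ?_, fun h => ?_⟩
  -- Edges integral for `f` do not cross the cut, so their slopes are unchanged.
  · rintro b ⟨e', rfl, he'⟩
    change (l e'.edge : ℤ) ∣ slope m f e' at he'
    rw [mem_integralEdges_iff, hslope]
    by_cases hh : e'.head ∈ S <;> by_cases ht : e'.tail ∈ S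
    · simpa [ind, hh, ht] using he'
    · exact absurd he' (hS e' hh ht)
    · refine absurd ?_ (hS e'.rev ht hh)
      rwa [slope_rev, dvd_neg]
    · simpa [ind, hh, ht] using he'
  · exact hS e he1 he2 ((mem_integralEdges_iff m f).1 (h ((mem_integralEdges_iff m _).2 he3)))

/-- The tiles with connected graphs cover `H0`. -/
theorem IsConnected.exists_isConnected_mem_tile [Finite V(G)] [Finite E(G)] (hG : IsConnected G)
    (hl : ∀ e, 0 < l e) (m : C1 G ℤ) {x : C0 G ℝ} (hx : x ∈ H0 G) :
    ∃ f : C0 G ℤ, IsConnected (subgraph l m f) ∧ x ∈ tile l m f := by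
  -- Among the tiles containing `x`, choose one whose set of integral edges is maximal.
  set A : Set (Set β) := {F | ∃ f : C0 G ℤ, F = integralEdges l m f ∧ x ∈ tile l m f} with hA
  have hfin : A.Finite := by
    refine (Set.Finite.finite_subsets (Set.toFinite E(G))).subset ?_
    rintro _ ⟨f, rfl, -⟩ b ⟨e, rfl, -⟩
    exact e.edge.2
  have hne : A.Nonempty := by
    obtain ⟨f, hf⟩ := hG.exists_mem_tile m hl hx
    exact ⟨_, f, rfl, hf⟩
  obtain ⟨F, hF⟩ := hfin.exists_maximal hne
  obtain ⟨f, rfl, a, ha, rfl⟩ := hF.prop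
  refine ⟨f, ?_, a, ha, rfl⟩
  by_contra hcon
  obtain ⟨g, h1, h2⟩ := exists_cube_supset hG hl hcon
  exact h2.2 (hF.2 ⟨g, rfl, a, h1 ha, rfl⟩ h2.1)

end Cover

end

section

variable {G : Graph α β}

/-! ### The cut Voronoi polytope as a tile. -/

section Voronoi

/-- The Laplacian as a linear map. -/
noncomputable def laplacianLin (G : Graph α β) [Finite V(G)] [Finite E(G)] :
    C0 G ℝ →ₗ[ℝ] C0 G ℝ :=
  dStarLin G ∘ₗ
    { toFun := d
      map_add' := fun f g => by
        ext e
        simp only [d, Pi.add_apply, Submodule.coe_add]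
        ring
      map_smul' := fun c f => by
        ext e
        simp only [d, Pi.smul_apply, SetLike.val_smul, smul_eq_mul, RingHom.id_apply]
        ring }

theorem laplacianLin_apply [Finite V(G)] [Finite E(G)] (f : C0 G ℝ) :
    laplacianLin G f = laplacian f := rfl

theorem laplacian_sub [Finite V(G)] [Finite E(G)] (f g : C0 G ℝ) :
    laplacian (f - g) = laplacian f - laplacian g :=
  (laplacianLin G).map_sub f g

theorem sum_mul_laplacian [Fintype V(G)] [Finite E(G)] [Fintype (Arrow G)] (f g : C0 G ℝ) :
    ∑ v, f v * laplacian g v =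
      (∑ e : Arrow G, (f e.head - f e.tail) * (g e.head - g e.tail)) / 2 :=
  sum_mul_dStar f (d g)

theorem IsConnected.exists_laplacian_eq [Finite V(G)] [Finite E(G)] (hG : IsConnected G)
    {x : C0 G ℝ} (hx : x ∈ H0 G) : ∃ f : C0 G ℝ, laplacian f = x := by
  have := finite_arrow G
  let _ := Fintype.ofFinite (Arrow G)
  let _ := Fintype.ofFinite V(G)
  obtain ⟨v₀⟩ := hG.nonempty
  have hcard : (Fintype.card V(G) : ℝ) ≠ 0 := by
    have : Nonempty V(G) := ⟨v₀⟩
    exact_mod_cast Fintype.card_ne_zero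
  -- Adding the all-ones matrix removes the constants from the kernel. On functions whose image has
  -- sum zero, the added term vanishes.
  let T : C0 G ℝ →ₗ[ℝ] C0 G ℝ := laplacianLin G +
    LinearMap.pi fun _ => ∑ v, LinearMap.proj v
  have hT : ∀ f w, T f w = laplacian f w + ∑ v, f v := by
    intro f w
    simp [T, laplacianLin_apply]
  have hsum : ∀ f, ∑ w, T f w = Fintype.card V(G) * ∑ v, f v := by
    intro f
    simp only [hT, Finset.sum_add_distrib, laplacian, mem_H0.1 (dStar_mem_H0 (d f))]
    simp
  have hinj : Function.Injective T := by
    rw [← LinearMap.ker_eq_bot, LinearMap.ker_eq_bot']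
    intro f hf
    have h0 : ∑ v, f v = 0 := by
      have h1 := hsum f
      rw [hf] at h1
      simp only [Pi.zero_apply, Finset.sum_const_zero] at h1
      exact (mul_eq_zero.1 h1.symm).resolve_left hcard
    have hlap : ∀ w, laplacian f w = 0 := by
      intro w
      have h1 := hT f w
      rw [hf, h0] at h1
      simpa using h1.symm
    have h2 := sum_mul_laplacian f f
    simp only [hlap, mul_zero, Finset.sum_const_zero] at h2
    have h3 : ∀ e : Arrow G, f e.head = f e.tail := by
      intro e
      have h4 : ∑ e : Arrow G, (f e.head - f e.tail) * (f e.head - f e.tail) = 0 := by linarith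
      rw [Finset.sum_eq_zero_iff_of_nonneg fun e _ => mul_self_nonneg _] at h4
      exact sub_eq_zero.1 (mul_self_eq_zero.1 (h4 e (Finset.mem_univ e)))
    have h5 : ∀ v, f v = f v₀ :=
      hG.induction (u := v₀) rfl fun e he => (h3 e).trans he
    have h6 : f v₀ = 0 := by
      simp only [h5, Finset.sum_const, Finset.card_univ, nsmul_eq_mul] at h0
      exact (mul_eq_zero.1 h0).resolve_left hcard
    ext v
    rw [h5, h6]
    rfl
  obtain ⟨f, hf⟩ := LinearMap.injective_iff_surjective.1 hinj x
  refine ⟨f, ?_⟩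
  have h1 := hsum f
  rw [hf, mem_H0.1 hx] at h1
  have h2 : ∑ v, f v = 0 := (mul_eq_zero.1 h1.symm).resolve_left hcard
  ext w
  rw [← hf, hT, h2, add_zero]

theorem cast_laplacian [Finite V(G)] [Finite E(G)] (n : C0 G ℤ) :
    (fun v => ((laplacian n v : ℤ) : ℝ)) = laplacian fun v => (n v : ℝ) := by
  classical
  have := finite_arrow G
  let _ := Fintype.ofFinite (Arrow G)
  ext v
  rw [laplacian, laplacian, dStar_apply]
  simp only [dStar, finsum_eq_sum_of_fintype, finsum_eq_if, d]
  push_cast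
  rfl

theorem laplacianForm_laplacian [Fintype V(G)] [Finite E(G)] (f : C0 G ℝ) :
    laplacianForm (laplacian f) = ∑ v, f v * laplacian f v := by
  rw [laplacianForm_eq, pairing, finsum_eq_sum_of_fintype]

/-- For unit length, `phi 1 t` is t²/2 at every integer. -/
theorem energy_one_zero [Fintype V(G)] [Finite E(G)] (n : C0 G ℤ) :
    energy (fun _ => 1) (0 : C1 G ℤ) n =
      (∑ v, (n v : ℝ) * laplacian (fun v => (n v : ℝ)) v) / 2 := by
  have := finite_arrow G
  let _ := Fintype.ofFinite (Arrow G)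
  rw [energy_eq, sum_mul_laplacian (fun v => (n v : ℝ)) fun v => (n v : ℝ)]
  congr 1
  rw [Finset.sum_div]
  refine Finset.sum_congr rfl fun e _ => ?_
  have : slope (0 : C1 G ℤ) n e = n e.head - n e.tail := by simp [slope]
  rw [this, phi]
  simp only [Nat.cast_one, Int.ediv_one]
  push_cast
  ring

/-- The cut Voronoi polytope is a tile of the untwisted tiling with unit lengths. -/
theorem IsConnected.cutVoronoi_eq_tile [Finite V(G)] [Finite E(G)] (hG : IsConnected G) :
    cutVoronoi G = tile (fun _ => 1) (0 : C1 G ℤ) 0 := by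
  let _ := Fintype.ofFinite V(G)
  have := finite_arrow G
  let _ := Fintype.ofFinite (Arrow G)
  ext x
  rw [mem_tile_iff fun _ => Nat.one_pos]
  refine and_congr_right fun hx => ?_
  obtain ⟨f, rfl⟩ := hG.exists_laplacian_eq hx
  -- Expanding q(Δf - Δn) turns the Voronoi inequality into 2⟨n, Δf⟩ ≤ ⟨n, Δn⟩, the subgradient
  -- inequality at 0.
  have key : ∀ n : C0 G ℤ,
      laplacianForm (laplacian f) ≤ laplacianForm (laplacian f - fun v => ((laplacian n v : ℤ) : ℝ))
      ↔ energy (fun _ => 1) (0 : C1 G ℤ) 0 +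
        ∑ v, ((n v : ℝ) - (0 : C0 G ℤ) v) * laplacian f v ≤
        energy (fun _ => 1) (0 : C1 G ℤ) n := by
    intro n
    rw [cast_laplacian, ← laplacian_sub, laplacianForm_laplacian, laplacianForm_laplacian,
      energy_one_zero, energy_one_zero]
    set r : C0 G ℝ := fun v => (n v : ℝ)
    have h1 : ∑ v, (f - r) v * laplacian (f - r) v = ∑ v, f v * laplacian f v -
        2 * ∑ v, r v * laplacian f v + ∑ v, r v * laplacian r v := by
      simp only [sum_mul_laplacian, Pi.sub_apply]
      rw [mul_div_assoc', Finset.mul_sum, ← sub_div, ← add_div, ← Finset.sum_sub_distrib,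
        ← Finset.sum_add_distrib]
      congr 1
      exact Finset.sum_congr rfl fun e _ => by ring
    have h2 : ∑ v, ((n v : ℝ) - ((0 : C0 G ℤ) v : ℤ)) * laplacian f v =
        ∑ v, r v * laplacian f v := by simp [r]
    have h3 : ∑ v, (((0 : C0 G ℤ) v : ℤ) : ℝ) *
        laplacian (fun v => (((0 : C0 G ℤ) v : ℤ) : ℝ)) v = 0 := by simp
    rw [h1, h2, h3]
    constructor <;> intro h <;> linarith
  constructor
  · exact fun h n => (key n).1 (h _ ⟨n, rfl⟩)
  · rintro h _ ⟨n, rfl⟩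
    exact (key n).2 (h n)

end Voronoi

/-! ### Comparison with spanning subgraphs. -/

section Restrict

variable {F : Set β}

/-- The arrows of a spanning subgraph as arrows of the graph. -/
def Arrow.ofRestrict (e : Arrow (G.restrict F)) : Arrow G where
  edge := ⟨e.edge.1, e.edge.2.1⟩
  tail := e.tail
  head := e.head
  isLink := e.isLink.2

theorem Arrow.ofRestrict_injective :
    Function.Injective (Arrow.ofRestrict : Arrow (G.restrict F) → Arrow G) := by
  rintro ⟨b, u, v, h⟩ ⟨b', u', v', h'⟩ heq
  obtain rfl : b = b' := Subtype.ext (congrArg (fun e : Arrow G => e.edge.1) heq)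
  obtain rfl : u = u' := congrArg Arrow.tail heq
  obtain rfl : v = v' := congrArg Arrow.head heq
  rfl

/-- An arrow of the graph along an edge of a spanning subgraph. -/
def Arrow.toRestrict (e : Arrow G) (h : e.edge.1 ∈ F) : Arrow (G.restrict F) where
  edge := ⟨e.edge.1, e.edge.2, h⟩
  tail := e.tail
  head := e.head
  isLink := ⟨h, e.isLink⟩

/-- Restriction of `1`-cochains to a spanning subgraph. -/
def C1.restrict (F : Set β) (a : C1 G ℝ) : C1 (G.restrict F) ℝ :=
  ⟨fun e => a.1 e.ofRestrict, fun e => a.2 e.ofRestrict⟩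

open Classical in
/-- Extension by zero of `1`-cochains of a spanning subgraph. -/
noncomputable def C1.extend (a : C1 (G.restrict F) ℝ) : C1 G ℝ :=
  ⟨fun e => if h : e.edge.1 ∈ F then a.1 (e.toRestrict h) else 0, fun e => by
    beta_reduce
    by_cases h : e.edge.1 ∈ F
    · rw [dif_pos h, dif_pos (show e.rev.edge.1 ∈ F from h)]
      exact a.2 (e.toRestrict h)
    · rw [dif_neg h, dif_neg (show e.rev.edge.1 ∉ F from h), neg_zero]⟩

theorem C1.restrict_extend (a : C1 (G.restrict F) ℝ) : C1.restrict F (C1.extend a) = a := by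
  ext e
  exact dif_pos e.edge.2.2

theorem dStar_restrict [Finite V(G)] [Finite E(G)] {a : C1 G ℝ}
    (ha : ∀ e : Arrow G, e.edge.1 ∉ F → a.1 e = 0) (v : V(G)) :
    dStar (G := G.restrict F) (C1.restrict F a) v = dStar a v := by
  classical
  have := finite_arrow G
  have : Finite (Arrow (G.restrict F)) := Finite.of_injective _ Arrow.ofRestrict_injective
  let _ := Fintype.ofFinite (Arrow G)
  let _ := Fintype.ofFinite (Arrow (G.restrict F))
  rw [dStar_apply a v]
  refine (dStar_apply (G := G.restrict F) (C1.restrict F a) v).trans ?_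
  refine Fintype.sum_of_injective Arrow.ofRestrict Arrow.ofRestrict_injective _ _ ?_ ?_
  · intro e he
    have : e.edge.1 ∉ F := fun h => he ⟨e.toRestrict h, rfl⟩
    rw [ha e this, ite_self]
  · intro e
    rfl

theorem mem_cube_one_zero {a : C1 G ℝ} :
    a ∈ cube (fun _ => 1) (0 : C1 G ℤ) 0 ↔ ∀ e, a.1 e ≤ 1 / 2 := by
  rw [mem_cube_iff fun _ => Nat.one_pos]
  refine forall_congr' fun e => ?_
  simp [delta_eq, slope]

/-- Restriction and extension by zero match the directions ε of the cube with the centred cube of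
the subgraph, compatibly with d*. The set `T` lives over `G` since the two vertex types agree only
by unfolding. -/
theorem tile_eq_vadd_tile [Finite V(G)] [Finite E(G)] (l : E(G) → ℕ) (m : C1 G ℤ)
    (f : C0 G ℤ) {T : Set (C0 G ℝ)} (hT : T = tile (G := subgraph l m f) (fun _ => 1) 0 0) :
    tile l m f = dStar (dPoint l m f) +ᵥ T := by
  subst hT
  ext x
  constructor
  · rintro ⟨_, ⟨ε, h1, h2, rfl⟩, rfl⟩
    refine ⟨dStar ε, ⟨C1.restrict _ ε, ?_, ?_⟩, ((dStarLin G).map_add _ _).symm⟩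
    · exact (mem_cube_one_zero (G := subgraph l m f)).2 fun e => (abs_le.1 (h1 e.ofRestrict)).2
    · exact funext (dStar_restrict fun e he => h2 e fun h => he h.2)
  · rintro ⟨_, ⟨a, ha, rfl⟩, rfl⟩
    have ha := mem_cube_one_zero.1 ha
    have hext : ∀ e : Arrow G, e.edge.1 ∉ integralEdges l m f → (C1.extend a).1 e = 0 :=
      fun e he => dif_neg he
    refine ⟨_, ⟨C1.extend a, fun e => ?_, fun e he => hext e fun h => he ⟨e.edge.2, h⟩, rfl⟩, ?_⟩
    · by_cases h : e.edge.1 ∈ integralEdges l m f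
      · have h0 : (C1.extend a).1 e = a.1 (e.toRestrict h) := dif_pos h
        have h1 := ha (e.toRestrict h)
        have h2 : -a.1 (e.toRestrict h) ≤ 1 / 2 :=
          (a.2 (e.toRestrict h)).symm.trans_le (ha (e.toRestrict h).rev)
        rw [h0, abs_le]
        constructor <;> linarith
      · rw [hext e h]
        norm_num
    · refine ((dStarLin G).map_add _ _).trans ?_
      have hext' : ∀ v : V(G), dStar a v = dStar (C1.extend a) v := fun v =>
        (congrFun (congrArg dStar (C1.restrict_extend a)).symm v).trans (dStar_restrict hext v)
      ext v
      exact congrArg (dStar (dPoint l m f) v + ·) (hext' v).symm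

/-- Each tile with connected graph is a translate of the cut Voronoi polytope of that graph. -/
theorem tile_eq_vadd_subgraphVoronoi [Finite V(G)] [Finite E(G)] {l : E(G) → ℕ} {m : C1 G ℤ}
    {f : C0 G ℤ} (hf : IsConnected (subgraph l m f)) :
    tile l m f = dStar (dPoint l m f) +ᵥ subgraphVoronoi l m f := by
  have : Finite V(subgraph l m f) := inferInstanceAs (Finite V(G))
  have : Finite E(subgraph l m f) :=
    ((Set.toFinite E(G)).subset Set.inter_subset_left).to_subtype
  exact tile_eq_vadd_tile l m f hf.cutVoronoi_eq_tile

end Restrict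

/-! ### Dimension of tiles and of their faces. -/

section Dimension

/-- `H0` as a submodule. -/
noncomputable def H0Submodule (G : Graph α β) [Fintype V(G)] : Submodule ℝ (C0 G ℝ) :=
  LinearMap.ker (∑ v, LinearMap.proj v : C0 G ℝ →ₗ[ℝ] ℝ)

theorem mem_H0Submodule [Fintype V(G)] {x : C0 G ℝ} : x ∈ H0Submodule G ↔ x ∈ H0 G := by
  simp [H0Submodule, mem_H0]

theorem finrank_H0Submodule [Fintype V(G)] [Nonempty V(G)] :
    Module.finrank ℝ (H0Submodule G) = Nat.card V(G) - 1 := by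
  classical
  have hne : (∑ v, LinearMap.proj v : C0 G ℝ →ₗ[ℝ] ℝ) ≠ 0 := by
    intro h
    obtain ⟨v⟩ := ‹Nonempty V(G)›
    have := LinearMap.congr_fun h (Pi.single v 1)
    simp at this
  have h1 := LinearMap.finrank_range_add_finrank_ker (∑ v, LinearMap.proj v : C0 G ℝ →ₗ[ℝ] ℝ)
  rw [LinearMap.range_eq_top.2 (LinearMap.surjective hne), finrank_top, Module.finrank_self,
    Module.finrank_fintype_fun_eq_card] at h1
  rw [Nat.card_eq_fintype_card, H0Submodule]
  lia

variable {l : E(G) → ℕ} {m : C1 G ℤ} {f : C0 G ℤ}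

theorem vectorSpan_le_H0Submodule [Fintype V(G)] [Finite E(G)] {P : Set (C0 G ℝ)}
    (hP : P ⊆ H0 G) : vectorSpan ℝ P ≤ H0Submodule G := by
  rw [vectorSpan_def, Submodule.span_le]
  rintro _ ⟨x, hx, y, hy, rfl⟩
  exact (H0Submodule G).sub_mem (mem_H0Submodule.2 (hP hx)) (mem_H0Submodule.2 (hP hy))

theorem vectorSpan_tile [Fintype V(G)] [Finite E(G)] (hf : IsConnected (subgraph l m f)) :
    vectorSpan ℝ (tile l m f) = H0Submodule G := by
  classical
  refine le_antisymm (vectorSpan_le_H0Submodule tile_subset_H0) fun x hx => ?_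
  let _ : Fintype V(subgraph l m f) := inferInstanceAs (Fintype V(G))
  rw [mem_H0Submodule] at hx
  refine hf.mem_of_mem_H0 (N := vectorSpan ℝ (tile l m f)) (fun e => ?_) hx
  set e' : Arrow G := Arrow.ofRestrict e
  have he' : e'.edge.1 ∈ E(subgraph l m f) := e.edge.2
  -- Moving from the centre along one integral edge stays in the cube; under d* this is half the
  -- difference of the indicators of its ends.
  have hmem : dPoint l m f + antisymm G (Pi.single e' 1) ∈ cube l m f := by
    refine ⟨_, fun b => ?_, fun b hb => ?_, rfl⟩
    · change |((Pi.single e' 1 : Arrow G → ℝ) b - (Pi.single e' 1 : Arrow G → ℝ) b.rev) / 2| ≤ _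
      rw [Pi.single_apply, Pi.single_apply]
      split_ifs <;> norm_num
    · change ((Pi.single e' 1 : Arrow G → ℝ) b - (Pi.single e' 1 : Arrow G → ℝ) b.rev) / 2 = 0
      have h1 : b ≠ e' := fun h => hb (h ▸ he')
      have h2 : b.rev ≠ e' := fun h => hb (by rw [← Arrow.rev_edge, h]; exact he')
      simp [h1, h2]
  have h1 := vsub_mem_vectorSpan ℝ (s := tile l m f) ⟨_, hmem, rfl⟩
    ⟨_, dPoint_mem_cube l m f, rfl⟩
  have h2 : dStar (dPoint l m f + antisymm G (Pi.single e' 1)) -ᵥ dStar (dPoint l m f) =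
      (1 / 2 : ℝ) • (Pi.single e'.head 1 - Pi.single e'.tail 1 : C0 G ℝ) := by
    rw [← dStar_antisymm_single, vsub_eq_sub, ← dStarLin_apply, map_add, dStarLin_apply,
      dStarLin_apply, add_sub_cancel_left]
  rw [h2] at h1
  have h3 := Submodule.smul_mem _ (2 : ℝ) h1
  rw [smul_smul] at h3
  norm_num at h3
  exact h3

theorem dim_tile [Finite V(G)] [Finite E(G)] (hf : IsConnected (subgraph l m f)) :
    dim (tile l m f) = Nat.card V(G) - 1 := by
  let _ := Fintype.ofFinite V(G)
  have : Nonempty V(G) := hf.nonempty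
  rw [dim, vectorSpan_tile hf, finrank_H0Submodule]

/-- A face of full dimension is the whole tile. -/
theorem eq_tile_of_isFace_of_dim [Finite V(G)] [Finite E(G)] {Q : Set (C0 G ℝ)}
    (hf : IsConnected (subgraph l m f)) (h : IsFace (tile l m f) Q)
    (hdim : dim Q = Nat.card V(G) - 1) : Q = tile l m f := by
  let _ := Fintype.ofFinite V(G)
  have : Nonempty V(G) := hf.nonempty
  obtain ⟨L, rfl⟩ := h.exists_toExposed
  set Q := L.toExposed (tile l m f)
  have hspan : vectorSpan ℝ Q = H0Submodule G :=
    Submodule.eq_of_le_of_finrank_eq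
      (vectorSpan_le_H0Submodule (h.2.subset.trans tile_subset_H0))
      (hdim.trans finrank_H0Submodule.symm)
  -- `L` is constant on the face it exposes, whose directions fill H₀.
  have hker : H0Submodule G ≤ LinearMap.ker (L : C0 G ℝ →ₗ[ℝ] ℝ) := by
    rw [← hspan, vectorSpan_def, Submodule.span_le]
    rintro _ ⟨x, hx, y, hy, rfl⟩
    change L (x - y) = 0
    rw [map_sub, sub_eq_zero]
    exact le_antisymm (hy.2 x hx.1) (hx.2 y hy.1)
  refine Set.Subset.antisymm h.2.subset fun x hx => ⟨hx, fun y hy => ?_⟩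
  have h1 : L (y - x) = 0 := hker ((H0Submodule G).sub_mem
    (mem_H0Submodule.2 (tile_subset_H0 hy)) (mem_H0Submodule.2 (tile_subset_H0 hx)))
  rw [map_sub, sub_eq_zero] at h1
  exact h1.le

end Dimension

/-! ### Assembly of the tiling and the main theorem. -/

theorem isTiling_cells [Finite V(G)] [Finite E(G)] (hG : IsConnected G) {l : E(G) → ℕ}
    (hl : ∀ e, 0 < l e) (m : C1 G ℤ) : IsTiling (H0 G) (cells l m) where
  polytope := by
    rintro P ⟨f, -, hP⟩
    exact (isPolytope_tile l m f).of_isFace hP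
  sUnion_eq := by
    refine Set.Subset.antisymm ?_ fun x hx => ?_
    · rintro x ⟨P, ⟨f, -, hP⟩, hx⟩
      exact tile_subset_H0 (hP.2.subset hx)
    · obtain ⟨f, hf, hxf⟩ := hG.exists_isConnected_mem_tile hl m hx
      exact ⟨_, ⟨f, hf, IsFace.refl ⟨x, hxf⟩⟩, hxf⟩
  face_mem := by
    rintro P ⟨f, hf, hP⟩ Q hQ
    exact ⟨f, hf, IsFace.trans (isPolytope_tile l m f) hP hQ⟩
  inter := by
    rintro P ⟨f, -, hP⟩ Q ⟨g, -, hQ⟩ hne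
    have hfg : ∀ f g, (tile l m f ∩ tile l m g).Nonempty →
        IsFace (tile l m f) (tile l m f ∩ tile l m g) ∧
          IsFace (tile l m g) (tile l m f ∩ tile l m g) := by
      intro f g h
      refine ⟨isFace_tile_inter hl h, ?_⟩
      rw [Set.inter_comm] at h ⊢
      exact isFace_tile_inter hl h
    refine ⟨hP.inter (isPolytope_tile l m f) (hfg f g) hQ hne, ?_⟩
    rw [Set.inter_comm] at hne ⊢
    exact hQ.inter (isPolytope_tile l m g) (hfg g f) hP hne

end

end GraphTiling

theorem mainTheorem2 {α β : Type*} (G : Graph α β) [Finite V(G)] [Finite E(G)] [G.Loopless]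
    (hG : GraphTiling.IsConnected G) (l : E(G) → ℕ) (hl : ∀ e, 0 < l e)
    (m : GraphTiling.C1 G ℤ) :
    GraphTiling.IsTiling (GraphTiling.H0 G) (GraphTiling.cells l m) ∧
    {P | P ∈ GraphTiling.cells l m ∧ GraphTiling.dim P = Nat.card V(G) - 1} =
      {P | ∃ f : GraphTiling.C0 G ℤ,
        GraphTiling.IsConnected (GraphTiling.subgraph l m f) ∧ P = GraphTiling.tile l m f} ∧
    ∀ f : GraphTiling.C0 G ℤ, GraphTiling.IsConnected (GraphTiling.subgraph l m f) →
      GraphTiling.tile l m f =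
        GraphTiling.dStar (GraphTiling.dPoint l m f) +ᵥ GraphTiling.subgraphVoronoi l m f := by
  refine ⟨GraphTiling.isTiling_cells hG hl m, ?_,
    fun f hf => GraphTiling.tile_eq_vadd_subgraphVoronoi hf⟩
  ext P
  constructor
  · rintro ⟨⟨f, hf, hP⟩, hdim⟩
    exact ⟨f, hf, GraphTiling.eq_tile_of_isFace_of_dim hf hP hdim⟩
  · rintro ⟨f, hf, rfl⟩
    exact ⟨⟨f, hf, GraphTiling.IsFace.refl (GraphTiling.tile_nonempty l m f)⟩,
      GraphTiling.dim_tile hf⟩
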